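/- Let $G\subseteq \mathrm{GL}_n(\mathbb C)$ be a complex linear algebraic group which, with its classical topology, is connected and simply connected. Let $\mathcal T_0$ be a Cartan subalgebra (a nilpotent, self-normalizing subalgebra) of the Lie algebra of $G$, and let $T_0\subseteq G$ be the connected subgroup with Lie algebra $\mathcal T_0$, i.e. the subgroup generated by $\exp(\mathcal T_0)$ (for reductive $G$ this is the Cartan torus with Lie algebra $\mathcal T_0$). Let $N(T_0)$ be the normalizer of $T_0$ in $G$, let $G/N(T_0)$ be the space of left cosets with the quotient topology, and let $I\in G/N(T_0)$ be the class of the identity. Then the fundamental group $\pi_1(G/N(T_0),I)$ is isomorphic to the Weyl group $W:=N(T_0)/T_0$. More precisely, there is a group isomorphism $\pi_1(G/N(T_0),I)\to W$ such that whenever a loop $\delta$ at $I$ lifts to a path in $G$ from the identity to an element $w\in N(T_0)$, the class of $\delta$ is sent to $wT_0$. (Here the product $pq$ in $\pi_1$ is: first $q$, then $p$.) Moreover, for every $n$, $\mathrm{SL}_n(\mathbb C)$ is an algebraic group which is connected and simply connected. -/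

import Mathlib

open scoped MatrixGroups

attribute [local instance 100] LieRing.ofAssociativeRing

namespace CartanTorus

variable {n : ℕ}

/-- The value at the matrix `A` of a polynomial `p` in the `n²` matrix coordinates. -/
noncomputable def evalAt (A : Matrix (Fin n) (Fin n) ℂ)
    (p : MvPolynomial (Fin n × Fin n) ℂ) : ℂ :=
  MvPolynomial.eval (fun ij => A ij.1 ij.2) p

/-- A subgroup of `GL_n(ℂ)` is a (complex linear) algebraic group when it is the set of common
zeros in `GL_n(ℂ)` of a set of polynomials in the matrix coordinates. (An equation involving
`1 / det` becomes one of this kind after multiplication by a power of `det`.) -/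
def IsAlgebraic (G : Subgroup (GL (Fin n) ℂ)) : Prop :=
  ∃ S : Set (MvPolynomial (Fin n × Fin n) ℂ),
    ∀ g : GL (Fin n) ℂ, g ∈ G ↔ ∀ p ∈ S, evalAt (g : Matrix (Fin n) (Fin n) ℂ) p = 0

/-- The polynomial `p` belongs to the vanishing ideal of `G`. -/
def Vanishes (G : Subgroup (GL (Fin n) ℂ)) (p : MvPolynomial (Fin n × Fin n) ℂ) : Prop :=
  ∀ g ∈ G, evalAt (g : Matrix (Fin n) (Fin n) ℂ) p = 0

/-- The differential at the identity matrix of the polynomial `p`, applied to `X`. -/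
noncomputable def diffOne (p : MvPolynomial (Fin n × Fin n) ℂ)
    (X : Matrix (Fin n) (Fin n) ℂ) : ℂ :=
  ∑ ij : Fin n × Fin n, X ij.1 ij.2 * evalAt 1 (MvPolynomial.pderiv ij p)

/-- The left invariant derivation attached to `X`: on the generic matrix `x` it is `x ↦ x X`. -/
noncomputable def invDer (X : Matrix (Fin n) (Fin n) ℂ) :
    Derivation ℂ (MvPolynomial (Fin n × Fin n) ℂ) (MvPolynomial (Fin n × Fin n) ℂ) :=
  MvPolynomial.mkDerivation ℂ
    (fun ij => ∑ k, MvPolynomial.C (X k ij.2) * MvPolynomial.X (ij.1, k))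

/-- The substitution `x ↦ g x`. -/
noncomputable def leftSubst (g : Matrix (Fin n) (Fin n) ℂ) :
    MvPolynomial (Fin n × Fin n) ℂ →ₐ[ℂ] MvPolynomial (Fin n × Fin n) ℂ :=
  MvPolynomial.aeval (fun ij => ∑ k, MvPolynomial.C (g ij.1 k) * MvPolynomial.X (k, ij.2))

theorem evalAt_leftSubst (g A : Matrix (Fin n) (Fin n) ℂ)
    (p : MvPolynomial (Fin n × Fin n) ℂ) :
    evalAt A (leftSubst g p) = evalAt (g * A) p := by
  induction p using MvPolynomial.induction_on with
  | C a => simp [evalAt, leftSubst]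
  | add p q hp hq =>
    simp only [evalAt, map_add] at hp hq ⊢
    rw [hp, hq]
  | mul_X p i hp =>
    simp only [evalAt, map_mul] at hp ⊢
    rw [hp]
    simp [leftSubst, Matrix.mul_apply]

theorem invDer_X (X : Matrix (Fin n) (Fin n) ℂ) (i j : Fin n) :
    invDer X (MvPolynomial.X (i, j)) =
      ∑ k, MvPolynomial.C (X k j) * MvPolynomial.X (i, k) := by
  simp [invDer, MvPolynomial.mkDerivation_X]

theorem invDer_C_mul (X : Matrix (Fin n) (Fin n) ℂ) (a : ℂ)
    (p : MvPolynomial (Fin n × Fin n) ℂ) :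
    invDer X (MvPolynomial.C a * p) = MvPolynomial.C a * invDer X p := by
  rw [← MvPolynomial.smul_eq_C_mul, ← MvPolynomial.smul_eq_C_mul, Derivation.map_smul]

theorem leftSubst_invDer (g X : Matrix (Fin n) (Fin n) ℂ)
    (p : MvPolynomial (Fin n × Fin n) ℂ) :
    leftSubst g (invDer X p) = invDer X (leftSubst g p) := by
  induction p using MvPolynomial.induction_on with
  | C a =>
    simp [leftSubst, ← MvPolynomial.algebraMap_eq]
  | add p q hp hq => simp only [map_add, hp, hq]
  | mul_X p i hp =>
    obtain ⟨i, j⟩ := i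
    have h : leftSubst g (invDer X (MvPolynomial.X (i, j))) =
        invDer X (leftSubst g (MvPolynomial.X (i, j))) := by
      rw [invDer_X]
      simp only [leftSubst, map_sum, map_mul, MvPolynomial.aeval_X, invDer_C_mul, invDer_X,
        MvPolynomial.algHom_C, MvPolynomial.algebraMap_eq, Finset.mul_sum]
      rw [Finset.sum_comm]
      refine Finset.sum_congr rfl fun _ _ => Finset.sum_congr rfl fun _ _ => by ring
    rw [Derivation.leibniz, map_add, map_mul, Derivation.leibniz, smul_eq_mul, smul_eq_mul,
      smul_eq_mul, smul_eq_mul, map_mul, map_mul, hp, h]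

theorem diffOne_eq (p : MvPolynomial (Fin n × Fin n) ℂ) (X : Matrix (Fin n) (Fin n) ℂ) :
    diffOne p X = evalAt 1 (invDer X p) := by
  induction p using MvPolynomial.induction_on with
  | C a => simp [diffOne, evalAt, ← MvPolynomial.algebraMap_eq]
  | add p q hp hq =>
    simp only [diffOne, evalAt, map_add, mul_add, Finset.sum_add_distrib] at hp hq ⊢
    rw [hp, hq]
  | mul_X p i hp =>
    obtain ⟨i, j⟩ := i
    have h1 : evalAt (1 : Matrix (Fin n) (Fin n) ℂ) (invDer X (MvPolynomial.X (i, j))) =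
        X i j := by
      rw [invDer_X]
      simp [evalAt, Matrix.one_apply]
    rw [Derivation.leibniz]
    simp only [diffOne, evalAt, Derivation.leibniz, map_add, map_mul, smul_eq_mul, mul_add,
      Finset.sum_add_distrib, MvPolynomial.pderiv_X] at hp h1 ⊢
    rw [h1, ← hp, Finset.mul_sum]
    congr 1
    · rw [Finset.sum_eq_single (i, j)]
      · simp; ring
      · intro b _ hb
        simp [hb.symm]
      · simp
    · refine Finset.sum_congr rfl fun _ _ => by ring

theorem invDer_lie (X Y : Matrix (Fin n) (Fin n) ℂ) : invDer ⁅X, Y⁆ = ⁅invDer X, invDer Y⁆ := by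
  apply MvPolynomial.derivation_ext
  rintro ⟨i, j⟩
  rw [Derivation.commutator_apply, invDer_X, invDer_X, invDer_X]
  simp only [map_sum, invDer_C_mul, invDer_X, Finset.mul_sum]
  rw [Finset.sum_comm, Finset.sum_comm (f := fun k l =>
    MvPolynomial.C (X k j) * (MvPolynomial.C (Y l k) * MvPolynomial.X (i, l))),
    ← Finset.sum_sub_distrib]
  refine Finset.sum_congr rfl fun l _ => ?_
  rw [Ring.lie_def, Matrix.sub_apply, Matrix.mul_apply, Matrix.mul_apply, map_sub, map_sum,
    map_sum, sub_mul, Finset.sum_mul, Finset.sum_mul]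
  simp only [map_mul]
  congr 1 <;> exact Finset.sum_congr rfl fun _ _ => by ring

theorem vanishes_invDer {G : Subgroup (GL (Fin n) ℂ)} {X : Matrix (Fin n) (Fin n) ℂ}
    (hX : ∀ p, Vanishes G p → diffOne p X = 0) {p : MvPolynomial (Fin n × Fin n) ℂ}
    (hp : Vanishes G p) : Vanishes G (invDer X p) := by
  intro g hg
  have h := hX (leftSubst (g : Matrix (Fin n) (Fin n) ℂ) p) (fun a ha => by
    rw [evalAt_leftSubst]
    exact hp (g * a) (G.mul_mem hg ha))
  rwa [diffOne_eq, ← leftSubst_invDer, evalAt_leftSubst, mul_one] at h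

/-- The Lie algebra of `G ⊆ GL_n(ℂ)`: the tangent space at the identity, that is, the matrices
killed by the differential at `1` of every polynomial vanishing on `G`, with the commutator
bracket. -/
noncomputable def lieAlgebra (G : Subgroup (GL (Fin n) ℂ)) :
    LieSubalgebra ℂ (Matrix (Fin n) (Fin n) ℂ) where
  carrier := {X | ∀ p, Vanishes G p → diffOne p X = 0}
  zero_mem' := fun p _ => by simp [diffOne]
  add_mem' := fun {X Y} hX hY p hp => by
    have h1 := hX p hp
    have h2 := hY p hp
    simp only [diffOne, Matrix.add_apply, add_mul, Finset.sum_add_distrib] at h1 h2 ⊢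
    rw [h1, h2, add_zero]
  smul_mem' := fun c X hX p hp => by
    have h1 := hX p hp
    simp only [diffOne, Matrix.smul_apply, smul_eq_mul, mul_assoc] at h1 ⊢
    rw [← Finset.mul_sum, h1, mul_zero]
  lie_mem' := fun {X Y} hX hY p hp => by
    have h1 := vanishes_invDer hX (vanishes_invDer hY hp) 1 G.one_mem
    have h2 := vanishes_invDer hY (vanishes_invDer hX hp) 1 G.one_mem
    simp only [Units.val_one, evalAt] at h1 h2
    rw [diffOne_eq, invDer_lie, Derivation.commutator_apply, evalAt, map_sub, h1, h2, sub_zero]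

/-- The connected subgroup of `G` with Lie algebra `𝔱`, that is, the subgroup generated by the
exponentials of the elements of `𝔱`. When `𝔱` is a Cartan subalgebra, this is the Cartan torus
attached to `𝔱` (the maximal tori of a connected reductive `G` are exactly the subgroups so
obtained). -/
noncomputable def cartanTorus (G : Subgroup (GL (Fin n) ℂ)) (𝔱 : LieSubalgebra ℂ (lieAlgebra G)) :
    Subgroup G :=
  Subgroup.closure {g : G | ∃ X ∈ 𝔱,
    ((g : GL (Fin n) ℂ) : Matrix (Fin n) (Fin n) ℂ) =
      NormedSpace.exp (X : Matrix (Fin n) (Fin n) ℂ)}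

/-- The normalizer `N(T₀)` in `G` of `T₀`. -/
abbrev torusNormalizer {G : Subgroup (GL (Fin n) ℂ)} (T₀ : Subgroup G) : Subgroup G :=
  Subgroup.normalizer (T₀ : Set G)

/-- The Weyl group `N(T₀) / T₀`. -/
abbrev WeylGroup {G : Subgroup (GL (Fin n) ℂ)} (T₀ : Subgroup G) : Type :=
  torusNormalizer T₀ ⧸ T₀.subgroupOf (torusNormalizer T₀)

/-- The special linear group as a subgroup of `GL_n(ℂ)`. -/
noncomputable def specialLinear (n : ℕ) : Subgroup (GL (Fin n) ℂ) :=
  (Matrix.GeneralLinearGroup.det : GL (Fin n) ℂ →* ℂˣ).ker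

end CartanTorus

/-!
Write `N` for the normalizer of `T₀` in `G` and `W = N / T₀`. The group `W` acts on `G / T₀` by
`(n T₀) • (g T₀) = g n⁻¹ T₀`, with quotient `G / N`. If `T₀` is open in `N`, then `G / T₀ → G / N`
is a covering with group `W` (`isQuotientCoveringMap_normalizer`), and if `G / T₀` is simply
connected, covering theory identifies `π₁ (G / N)` with `W`, the monodromy being computed by lifts
to `G` (`exists_fundamentalGroup_quotient_normalizer_mulEquiv`). The quotient `G / T₀` is simply
connected because paths lift to the simply connected group `G` and the fibre `T₀` is path connected
(`simplyConnectedSpace_quotient`).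

So there are two things to prove about `T₀`: it is open in `N`, and paths in `G / T₀` lift to `G`.
They follow from one fact. Let `𝔱` be the Cartan subalgebra and `M` the normalizer of `𝔱` in `G` for
the adjoint action, a closed subgroup of `GL_n(ℂ)`. A matrix `X` generates a one-parameter subgroup
of `M` exactly when `X` lies in the Lie algebra of `G` and normalizes `𝔱`; as `𝔱` is
self-normalizing, this says that `X ∈ 𝔱` (`mem_matrixSpace_iff_expUnit_mem`). That the Lie algebra
defined by polynomial equations is the one defined by the exponential is Taylor's formula for
`z ↦ p (exp (z X))`, whose derivatives are again of this form. The closed subgroup theorem in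
adapted coordinates (`exists_chart_adapted`) now shows that near the identity `M` consists of
exponentials of elements of `𝔱`, hence of elements of `T₀`; since `T₀ ≤ N ≤ M`, the group `T₀` is
open in `N`. The same coordinates give a local section of `GL_n(ℂ) → GL_n(ℂ) / T₀`
(`hasLocalSection_of_expUnit_mem`), along which paths lift.

For `SL_n(ℂ)` the argument is by induction on `n`. A loop in `SL_n(ℂ)` moves the first basis vector
along a loop in `ℂⁿ ∖ {0}`, which is contractible there when `n ≥ 2`: a polynomial loop avoids a ray
from the origin (`isSimplyConnected_compl_zero`). Homotopies lift along `g ↦ g x`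
(`exists_specialLinear_lift`), because a determinant one matrix carrying `x` to `y` can be chosen
continuously for `⟪x, y⟫` of positive real part. So the loop is deformed into the stabilizer of the
first basis vector, which retracts onto `SL_{n-1}(ℂ)`.
-/

namespace CartanTorus

/-! ### Quotients of simply connected topological groups -/

section TopologicalGroup

open Topology unitInterval

variable {Γ : Type*} [Group Γ] [TopologicalSpace Γ]

theorem continuousOn_cosetSection [IsTopologicalGroup Γ] {T : Subgroup Γ} {U : Set Γ}
    (hU : IsOpen U) {s : Γ → Γ} (hs : ContinuousOn s U) {sec : Γ ⧸ T → Γ}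
    (hsec : ∀ u ∈ U, sec (QuotientGroup.mk u) = s u) :
    ContinuousOn sec ((QuotientGroup.mk : Γ → Γ ⧸ T) '' U) := by
  rintro _ ⟨u, hu, rfl⟩
  refine ContinuousAt.continuousWithinAt ?_
  intro O hO
  rw [hsec u hu] at hO
  have h1 : U ∩ s ⁻¹' O ∈ 𝓝 u :=
    Filter.inter_mem (hU.mem_nhds hu) ((hs.continuousAt (hU.mem_nhds hu)) hO)
  rw [Filter.mem_map]
  refine Filter.mem_of_superset
    (QuotientGroup.isOpenQuotientMap_mk.isOpenMap.image_mem_nhds h1) ?_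
  rintro _ ⟨v, hv, rfl⟩
  rw [Set.mem_preimage, hsec v hv.1]
  exact hv.2

/-- A subgroup admits local cross-sections. The section near the identity coset is encoded by a
map `s` on a neighbourhood of `1` which picks a point of each coset continuously. -/
def HasLocalSection (T : Subgroup Γ) : Prop :=
  ∃ U : Set Γ, IsOpen U ∧ 1 ∈ U ∧ ∃ s : Γ → Γ, ContinuousOn s U ∧ (∀ u ∈ U, (s u)⁻¹ * u ∈ T) ∧
    ∀ u ∈ U, ∀ v ∈ U, u⁻¹ * v ∈ T → s u = s v

theorem HasLocalSection.exists_section [IsTopologicalGroup Γ] {T : Subgroup Γ}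
    (h : HasLocalSection T) :
    ∃ (V : Set (Γ ⧸ T)) (sec : Γ ⧸ T → Γ), IsOpen V ∧ QuotientGroup.mk 1 ∈ V ∧ ContinuousOn sec V ∧
      ∀ x ∈ V, QuotientGroup.mk (sec x) = x := by
  classical
  obtain ⟨U, hU, h1, s, hs, hsT, hsc⟩ := h
  let sec : Γ ⧸ T → Γ := fun x =>
    if hx : ∃ u ∈ U, (QuotientGroup.mk u : Γ ⧸ T) = x then s hx.choose else 1
  have hsec : ∀ u ∈ U, sec (QuotientGroup.mk u) = s u := by
    intro u hu
    have hx : ∃ v ∈ U, (QuotientGroup.mk v : Γ ⧸ T) = QuotientGroup.mk u := ⟨u, hu, rfl⟩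
    simp only [sec, dif_pos hx]
    exact hsc _ hx.choose_spec.1 _ hu (QuotientGroup.eq.1 hx.choose_spec.2)
  refine ⟨QuotientGroup.mk '' U, sec, QuotientGroup.isOpenQuotientMap_mk.isOpenMap _ hU,
    ⟨1, h1, rfl⟩, continuousOn_cosetSection hU hs hsec, ?_⟩
  rintro _ ⟨u, hu, rfl⟩
  rw [hsec u hu]
  exact QuotientGroup.eq.2 (hsT u hu)

theorem HasLocalSection.exists_path_lift [IsTopologicalGroup Γ] {T : Subgroup Γ}
    (h : HasLocalSection T) (δ : C(I, Γ ⧸ T)) (g : Γ) (hg : QuotientGroup.mk g = δ 0) :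
    ∃ γ : C(I, Γ), γ 0 = g ∧ ∀ t, (QuotientGroup.mk (γ t) : Γ ⧸ T) = δ t := by
  obtain ⟨V, sec, hV, h1V, hsec, hsecm⟩ := h.exists_section
  obtain ⟨t, t_0, t_mono, ⟨n_max, h_max⟩, t_sub⟩ :=
    exists_monotone_Icc_subset_open_cover_unitInterval
    (c := fun a : Γ => {τ : I | a⁻¹ • δ τ ∈ V})
    (fun a => hV.preimage (δ.continuous.const_smul a⁻¹)) (fun τ _ => by
      obtain ⟨a, ha⟩ := QuotientGroup.mk_surjective (δ τ)
      refine Set.mem_iUnion.2 ⟨a, ?_⟩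
      simpa [← ha, ← QuotientGroup.mk_mul, MulAction.Quotient.smul_mk] using h1V)
  suffices ∀ n, ∃ γ : I → Γ, ContinuousOn γ (Set.Icc 0 (t n)) ∧ γ 0 = g ∧
      ∀ τ ∈ Set.Icc 0 (t n), (QuotientGroup.mk (γ τ) : Γ ⧸ T) = δ τ by
    obtain ⟨γ, cont, γ0, hγ⟩ := this n_max
    rw [h_max _ le_rfl] at cont hγ
    have huniv : Set.Icc (0 : I) 1 = Set.univ :=
      Set.eq_univ_iff_forall.2 fun t => ⟨bot_le, le_top⟩
    rw [huniv, continuousOn_univ] at cont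
    exact ⟨⟨γ, cont⟩, γ0, fun τ => hγ τ (huniv ▸ Set.mem_univ τ)⟩
  intro n
  induction n with
  | zero =>
    refine ⟨fun _ => g, continuousOn_const, rfl, fun τ hτ => ?_⟩
    rw [t_0, Set.Icc_self, Set.mem_singleton_iff] at hτ
    rw [hτ, hg]
  | succ n ih =>
    obtain ⟨γ, cont, γ0, hγ⟩ := ih
    obtain ⟨a, ha⟩ := t_sub n
    -- `r` is a lift of `δ` over the new interval; a right translate by an element of `T` makes
    -- it start at the end point of `γ`.
    let r : I → Γ := fun τ => a * sec (a⁻¹ • δ τ)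
    have hr : ContinuousOn r (Set.Icc (t n) (t (n + 1))) :=
      continuousOn_const.mul (hsec.comp (δ.continuous.const_smul a⁻¹).continuousOn ha)
    have hrδ : ∀ τ ∈ Set.Icc (t n) (t (n + 1)), (QuotientGroup.mk (r τ) : Γ ⧸ T) = δ τ := by
      intro τ hτ
      have := hsecm _ (ha hτ)
      simp only [r]
      rw [← smul_eq_mul, ← MulAction.Quotient.smul_mk, this, smul_inv_smul]
    have hn : t n ∈ Set.Icc (t n) (t (n + 1)) := ⟨le_rfl, t_mono n.le_succ⟩
    have h0n : (0 : I) ≤ t n := t_0 ▸ t_mono n.zero_le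
    have hT : (r (t n))⁻¹ * γ (t n) ∈ T := by
      rw [← QuotientGroup.eq, hrδ _ hn, hγ _ ⟨h0n, le_rfl⟩]
    refine ⟨fun τ => if τ ≤ t n then γ τ else r τ * ((r (t n))⁻¹ * γ (t n)),
      .if (fun τ hτ => ?_) (cont.mono fun _ h => ?_) ?_, ?_, fun τ hτ => ?_⟩
    · cases frontier_Iic_subset _ hτ.2
      group
    · rw [closure_le_eq continuous_id' continuous_const] at h; exact ⟨h.1.1, h.2⟩
    · refine (hr.mul continuousOn_const).mono ?_
      simp_rw [not_le]
      intro s h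
      exact ⟨closure_lt_subset_le continuous_const continuous_subtype_val h.2, h.1.2⟩
    · dsimp only; rwa [if_pos h0n]
    · dsimp only
      split_ifs with hle
      · exact hγ _ ⟨hτ.1, hle⟩
      · rw [QuotientGroup.mk_mul_of_mem _ hT]
        exact hrδ _ ⟨le_of_not_ge hle, hτ.2⟩

theorem simplyConnectedSpace_of_loops_at {X : Type*} [TopologicalSpace X] [PathConnectedSpace X]
    (x₀ : X) (h : ∀ δ : Path x₀ x₀, Path.Homotopic δ (Path.refl x₀)) : SimplyConnectedSpace X := by
  rw [simply_connected_iff_loops_nullhomotopic]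
  refine ⟨inferInstance, fun x δ => ?_⟩
  have hsub : Subsingleton (FundamentalGroup X x₀) :=
    ⟨fun p q => by
      induction p using Path.Homotopic.Quotient.ind with | mk p => ?_
      induction q using Path.Homotopic.Quotient.ind with | mk q => ?_
      exact Path.Homotopic.Quotient.eq.2 ((h p).trans (h q).symm)⟩
  have := (FundamentalGroup.fundamentalGroupMulEquivOfPathConnected (X := X)
    x₀ x).symm.injective.subsingleton
  exact Path.Homotopic.Quotient.eq.1 (Subsingleton.elim (α := FundamentalGroup X x)
    (Path.Homotopic.Quotient.mk δ) (Path.Homotopic.Quotient.mk (Path.refl x)))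

/-- If paths lift along `Γ → Γ ⧸ T` and `T` is path connected, a loop in `Γ ⧸ T` lifts to a path
that can be closed up inside `T`; so `Γ ⧸ T` is simply connected when `Γ` is. -/
theorem simplyConnectedSpace_quotient [SimplyConnectedSpace Γ] (T : Subgroup Γ)
    (hT : ∀ t : T, Joined 1 t)
    (hlift : ∀ δ : C(I, Γ ⧸ T), δ 0 = QuotientGroup.mk 1 →
      ∃ γ : C(I, Γ), γ 0 = 1 ∧ ∀ t, (QuotientGroup.mk (γ t) : Γ ⧸ T) = δ t) :
    SimplyConnectedSpace (Γ ⧸ T) := by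
  have hcont : Continuous (QuotientGroup.mk : Γ → Γ ⧸ T) := QuotientGroup.continuous_mk
  have hpc : PathConnectedSpace (Γ ⧸ T) :=
    QuotientGroup.mk_surjective.pathConnectedSpace hcont
  have hloop : ∀ δ : Path (QuotientGroup.mk 1 : Γ ⧸ T) (QuotientGroup.mk 1),
      Path.Homotopic δ (Path.refl _) := by
    intro δ
    obtain ⟨γ, γ0, hγ⟩ := hlift δ.toContinuousMap δ.source
    have h1 : γ 1 ∈ T := by
      have := hγ 1
      rw [show δ.toContinuousMap 1 = QuotientGroup.mk 1 from δ.target, eq_comm,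
        QuotientGroup.eq] at this
      simpa using this
    obtain ⟨β⟩ := hT ⟨γ 1, h1⟩
    let γ' : Path (1 : Γ) (γ 1) := ⟨γ, γ0, rfl⟩
    let β' : Path (1 : Γ) (γ 1) := β.map continuous_subtype_val
    have h := (SimplyConnectedSpace.paths_homotopic γ' β').map ⟨_, hcont⟩
    have e1 : QuotientGroup.mk (γ 1) = (QuotientGroup.mk 1 : Γ ⧸ T) := by
      rw [eq_comm, QuotientGroup.eq]; simpa using h1
    have e2 : δ = (γ'.map hcont).cast rfl e1.symm := by
      ext t
      exact (hγ t).symm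
    have e3 : Path.refl _ = (β'.map hcont).cast rfl e1.symm := by
      ext t
      refine QuotientGroup.eq.2 ?_
      rw [inv_one, one_mul]
      exact (β t).2
    rw [e2, e3]
    exact h
  exact simplyConnectedSpace_of_loops_at _ hloop

/-- The group `N(T) / T` acts on `Γ ⧸ T` by `(n T) • (g T) = g n⁻¹ T`. -/
noncomputable instance weylAction {Γ : Type*} [Group Γ] (T : Subgroup Γ) : MulAction
    (Subgroup.normalizer (T : Set Γ) ⧸ T.subgroupOf (Subgroup.normalizer (T : Set Γ)))
    (Γ ⧸ T) where
  smul w x := Quotient.map₂ (fun (n : Subgroup.normalizer (T : Set Γ)) (g : Γ) => g * (n : Γ)⁻¹)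
    (by
      intro n n' hn g g' hg
      rw [← Quotient.eq_iff_equiv] at hn hg ⊢
      have hn' : (n : Γ)⁻¹ * n' ∈ T := Subgroup.mem_subgroupOf.1 (QuotientGroup.eq.1 hn)
      have hg' : g⁻¹ * g' ∈ T := QuotientGroup.eq.1 hg
      refine QuotientGroup.eq.2 ?_
      have h1 := (Subgroup.mem_normalizer_iff.1 n.2 _).1 (mul_mem hg' (inv_mem hn'))
      simpa [mul_assoc] using h1) w x
  one_smul x := by
    induction x using QuotientGroup.induction_on with | H g => ?_
    exact congrArg QuotientGroup.mk (by simp)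
  mul_smul v w x := by
    induction x using QuotientGroup.induction_on with | H g => ?_
    induction v using QuotientGroup.induction_on with | H m => ?_
    induction w using QuotientGroup.induction_on with | H n => ?_
    exact congrArg QuotientGroup.mk (by simp [mul_assoc])

theorem weylAction_mk {Γ : Type*} [Group Γ] (T : Subgroup Γ)
    (n : Subgroup.normalizer (T : Set Γ)) (g : Γ) :
    (QuotientGroup.mk n : Subgroup.normalizer (T : Set Γ) ⧸
      T.subgroupOf (Subgroup.normalizer (T : Set Γ))) • (QuotientGroup.mk g : Γ ⧸ T) =
      QuotientGroup.mk (g * (n : Γ)⁻¹) := rfl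

variable {T : Subgroup Γ}

/-- If `T` is open in its normalizer `N`, then `Γ ⧸ T → Γ ⧸ N` is a covering with group
`N ⧸ T`. -/
theorem isQuotientCoveringMap_normalizer [IsTopologicalGroup Γ]
    (hT : ∀ᶠ g in 𝓝 (1 : Γ), g ∈ Subgroup.normalizer (T : Set Γ) → g ∈ T) :
    IsQuotientCoveringMap
      (Subgroup.quotientMapOfLE (Subgroup.le_normalizer : T ≤ Subgroup.normalizer (T : Set Γ)))
      (Subgroup.normalizer (T : Set Γ) ⧸ T.subgroupOf (Subgroup.normalizer (T : Set Γ))) where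
  toIsQuotientMap := by
    refine IsQuotientMap.of_comp (f := (QuotientGroup.mk : Γ → Γ ⧸ T))
      QuotientGroup.continuous_mk ?_ (QuotientGroup.isQuotientMap_mk _)
    exact (QuotientGroup.isQuotientMap_mk _).continuous_iff.2 QuotientGroup.continuous_mk
  continuous_const_smul w := by
    induction w using QuotientGroup.induction_on with | H n => ?_
    refine (QuotientGroup.isQuotientMap_mk _).continuous_iff.2 ?_
    exact QuotientGroup.continuous_mk.comp (continuous_id.mul continuous_const)
  apply_eq_iff_mem_orbit {x y} := by
    induction x using QuotientGroup.induction_on with | H g => ?_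
    induction y using QuotientGroup.induction_on with | H h => ?_
    rw [Subgroup.quotientMapOfLE_apply_mk, Subgroup.quotientMapOfLE_apply_mk, QuotientGroup.eq]
    constructor
    · intro hn
      refine ⟨QuotientGroup.mk ⟨_, hn⟩, ?_⟩
      dsimp only
      rw [weylAction_mk]
      congr 1
      simp
    · rintro ⟨w, hw⟩
      induction w using QuotientGroup.induction_on with | H n => ?_
      dsimp only at hw
      rw [weylAction_mk, QuotientGroup.eq] at hw
      have := mul_mem (inv_mem (Subgroup.le_normalizer hw)) n.2
      simpa [mul_assoc] using this
  disjoint x := by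
    induction x using QuotientGroup.induction_on with | H g => ?_
    have hdiv : Filter.Tendsto (fun p : Γ × Γ => p.1⁻¹ * p.2) (𝓝 (g, g)) (𝓝 1) := by
      have : Continuous fun p : Γ × Γ => p.1⁻¹ * p.2 := by fun_prop
      simpa using this.tendsto (g, g)
    have hev := hdiv.eventually hT
    rw [nhds_prod_eq] at hev
    obtain ⟨U, hU, hUT⟩ := (Filter.eventually_prod_self_iff (r := fun a b : Γ =>
      a⁻¹ * b ∈ Subgroup.normalizer (T : Set Γ) → a⁻¹ * b ∈ T)).1 hev
    refine ⟨QuotientGroup.mk '' U,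
      QuotientGroup.isOpenQuotientMap_mk.isOpenMap.image_mem_nhds hU, ?_⟩
    rintro w ⟨_, ⟨_, ⟨u, hu, rfl⟩, rfl⟩, v, hv, huv⟩
    induction w using QuotientGroup.induction_on with | H n => ?_
    dsimp only at huv
    rw [weylAction_mk, QuotientGroup.eq] at huv
    have hN : v⁻¹ * u ∈ Subgroup.normalizer (T : Set Γ) := by
      have := mul_mem (Subgroup.le_normalizer huv) n.2
      simpa [mul_assoc] using this
    have := hUT v hv u hu hN
    rw [QuotientGroup.eq_one_iff, Subgroup.mem_subgroupOf]
    have h2 := mul_mem (inv_mem huv) this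
    simpa [mul_assoc] using h2

/-- The fundamental group of `Γ ⧸ N(T)`, for `Γ` simply connected. The isomorphism is the one
coming from the covering `Γ ⧸ T → Γ ⧸ N(T)` by a simply connected space; the inversion turns the
opposite group into the group itself. -/
theorem exists_fundamentalGroup_quotient_normalizer_mulEquiv [IsTopologicalGroup Γ]
    [SimplyConnectedSpace Γ]
    (hjoin : ∀ t : T, Joined 1 t)
    (hT : ∀ᶠ g in 𝓝 (1 : Γ), g ∈ Subgroup.normalizer (T : Set Γ) → g ∈ T)
    (hlift : ∀ δ : C(I, Γ ⧸ T), δ 0 = QuotientGroup.mk 1 →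
      ∃ γ : C(I, Γ), γ 0 = 1 ∧ ∀ t, (QuotientGroup.mk (γ t) : Γ ⧸ T) = δ t) :
    ∃ e : FundamentalGroup (Γ ⧸ Subgroup.normalizer (T : Set Γ)) (QuotientGroup.mk (1 : Γ)) ≃*
        (Subgroup.normalizer (T : Set Γ) ⧸ T.subgroupOf (Subgroup.normalizer (T : Set Γ))),
      ∀ (δ : Path (QuotientGroup.mk (1 : Γ) : Γ ⧸ Subgroup.normalizer (T : Set Γ))
          (QuotientGroup.mk (1 : Γ)))
        (w : Subgroup.normalizer (T : Set Γ)) (γ : Path (1 : Γ) (w : Γ)),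
        (∀ t, (QuotientGroup.mk (γ t) : Γ ⧸ Subgroup.normalizer (T : Set Γ)) = δ t) →
        e (FundamentalGroup.fromPath (Path.Homotopic.Quotient.mk δ)) = QuotientGroup.mk w := by
  have hcov := isQuotientCoveringMap_normalizer hT
  have := simplyConnectedSpace_quotient T hjoin hlift
  let b : Subgroup.quotientMapOfLE (Subgroup.le_normalizer : T ≤ Subgroup.normalizer (T : Set Γ))
      ⁻¹' {(QuotientGroup.mk (1 : Γ) : Γ ⧸ Subgroup.normalizer (T : Set Γ))} :=
    ⟨QuotientGroup.mk 1, rfl⟩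
  refine ⟨(hcov.fundamentalGroupEquiv b).trans (MulEquiv.inv' _).symm, fun δ w γ hγ => ?_⟩
  have hw : (QuotientGroup.mk (w : Γ) : Γ ⧸ Subgroup.normalizer (T : Set Γ)) =
      QuotientGroup.mk 1 := by
    rw [eq_comm, QuotientGroup.eq]; simp
  rw [MulEquiv.trans_apply, MulEquiv.symm_apply_eq]
  refine (hcov.fundamentalGroupToMulOpposite_apply_eq_Iff (e := b)).2 ?_
  have hmono := hcov.isCoveringMap.monodromy_eq_of_map_eq
    (γ := Path.Homotopic.Quotient.mk δ) (ex := b)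
    (ey := ⟨QuotientGroup.mk (w : Γ), hw⟩)
    (Path.Homotopic.Quotient.mk (γ.map QuotientGroup.continuous_mk)) (by
      change Path.Homotopic.Quotient.mk _ = Path.Homotopic.Quotient.mk _
      congr 1
      ext t
      exact hγ t)
  refine Eq.trans ?_ (congrArg Subtype.val hmono).symm
  change (QuotientGroup.mk w : Subgroup.normalizer (T : Set Γ) ⧸
      T.subgroupOf (Subgroup.normalizer (T : Set Γ)))⁻¹ • (QuotientGroup.mk 1 : Γ ⧸ T) = _
  rw [← QuotientGroup.mk_inv, weylAction_mk]
  simp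

end TopologicalGroup

/-! ### Closed subgroups of the unit group of a Banach algebra -/

section Exp

open Topology Filter

variable {E : Type*} [NormedRing E] [NormedAlgebra ℝ E] [CompleteSpace E]

/-- The exponential as an element of the group of units. -/
noncomputable def expUnit (X : E) : Eˣ :=
  letI : NormedAlgebra ℚ E := .restrictScalars ℚ ℝ E
  { val := NormedSpace.exp X
    inv := NormedSpace.exp (-X)
    val_inv := by
      rw [← NormedSpace.exp_add_of_commute (Commute.neg_right (Commute.refl X)), add_neg_cancel,
        NormedSpace.exp_zero]
    inv_val := by
      rw [← NormedSpace.exp_add_of_commute (Commute.neg_left (Commute.refl X)), neg_add_cancel,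
        NormedSpace.exp_zero] }

@[simp] theorem val_expUnit (X : E) : (expUnit X : E) = NormedSpace.exp X := rfl

theorem expUnit_add {X Y : E} (h : Commute X Y) : expUnit (X + Y) = expUnit X * expUnit Y := by
  let _ : NormedAlgebra ℚ E := .restrictScalars ℚ ℝ E
  ext
  exact NormedSpace.exp_add_of_commute h

@[simp] theorem expUnit_zero : expUnit (0 : E) = 1 := by
  ext
  simp

theorem expUnit_neg (X : E) : expUnit (-X) = (expUnit X)⁻¹ := by
  rw [eq_inv_iff_mul_eq_one, ← expUnit_add (Commute.neg_left (Commute.refl X)), neg_add_cancel,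
    expUnit_zero]

theorem expUnit_zsmul (m : ℤ) (X : E) : expUnit (m • X) = expUnit X ^ m := by
  have hn : ∀ k : ℕ, expUnit (k • X) = expUnit X ^ k := by
    intro k
    induction k with
    | zero => simp
    | succ k ih =>
      rw [succ_nsmul, expUnit_add (Commute.smul_left (Commute.refl X) k), ih, pow_succ]
  cases m with
  | ofNat k => simpa using hn k
  | negSucc k => rw [negSucc_zsmul, expUnit_neg, hn, zpow_negSucc]

theorem expUnit_conj (u : Eˣ) (X : E) : expUnit (u * X * ↑u⁻¹ : E) = u * expUnit X * u⁻¹ := by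
  let _ : NormedAlgebra ℚ E := .restrictScalars ℚ ℝ E
  ext
  exact NormedSpace.exp_units_conj u X

theorem continuous_expUnit : Continuous (expUnit : E → Eˣ) := by
  let _ : NormedAlgebra ℚ E := .restrictScalars ℚ ℝ E
  rw [Units.continuous_iff]
  refine ⟨NormedSpace.exp_continuous, ?_⟩
  have h : (fun X : E => ((expUnit X)⁻¹ : Eˣ).val) = fun X => NormedSpace.exp (-X) := by
    ext X
    rw [← expUnit_neg]
    rfl
  rw [h]
  exact NormedSpace.exp_continuous.comp continuous_neg

variable [FiniteDimensional ℝ E]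

/-- A closed subgroup `M` meets a subspace `C`, transverse to its one-parameter subgroups, only
at the identity near the identity. If `Xₖ → 0` in `C` were nonzero with `exp Xₖ ∈ M`, then a limit
`X` of the directions of the `Xₖ` would satisfy `exp (t X) = lim exp (⌊t / ‖Xₖ‖⌋ Xₖ) ∈ M`. -/
theorem eventually_expUnit_mem_imp_eq_zero {M : Subgroup Eˣ} (hM : IsClosed (M : Set Eˣ))
    {V C : Submodule ℝ E} (hV : ∀ X, (∀ t : ℝ, expUnit (t • X) ∈ M) → X ∈ V)
    (hVC : Disjoint V C) :
    ∀ᶠ X in 𝓝 (0 : E), X ∈ C → expUnit X ∈ M → X = 0 := by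
  by_contra hcon
  obtain ⟨x, hx0, hx⟩ := exists_seq_forall_of_frequently (not_eventually.1 hcon)
  simp only [not_forall] at hx
  choose hxC hxM hxne using hx
  have hnorm : ∀ k, 0 < ‖x k‖ := fun k => norm_pos_iff.2 (hxne k)
  have : ProperSpace E := FiniteDimensional.proper ℝ E
  obtain ⟨X, hX, φ, hφ, hlim⟩ := (isCompact_sphere (0 : E) 1).tendsto_subseq
    (x := fun k => ‖x k‖⁻¹ • x k) (fun k => by
      rw [mem_sphere_zero_iff_norm, norm_smul, norm_inv, norm_norm,
        inv_mul_cancel₀ (hnorm k).ne'])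
  have hXC : X ∈ C := C.closed_of_finiteDimensional.mem_of_tendsto hlim
    (Eventually.of_forall fun k => C.smul_mem _ (hxC _))
  have hxφ : Tendsto (fun k => ‖x (φ k)‖) atTop (𝓝 0) := by
    simpa using (hx0.comp hφ.tendsto_atTop).norm
  have hXV : X ∈ V := by
    refine hV X fun t => ?_
    have ht : Tendsto (fun k => (⌊t / ‖x (φ k)‖⌋ : ℝ) * ‖x (φ k)‖) atTop (𝓝 t) := by
      have hle : ∀ k, |(⌊t / ‖x (φ k)‖⌋ : ℝ) * ‖x (φ k)‖ - t| ≤ ‖x (φ k)‖ := by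
        intro k
        have h1 := Int.floor_le (t / ‖x (φ k)‖)
        have h2 := (Int.lt_floor_add_one (t / ‖x (φ k)‖)).le
        rw [le_div_iff₀ (hnorm _)] at h1
        rw [div_le_iff₀ (hnorm _)] at h2
        rw [abs_le]
        constructor <;> linarith
      have := squeeze_zero_norm (fun k => (Real.norm_eq_abs _).trans_le (hle k)) hxφ
      simpa using this.add_const t
    have hmul : Tendsto (fun k => expUnit (⌊t / ‖x (φ k)‖⌋ • x (φ k))) atTop
        (𝓝 (expUnit (t • X))) := by
      refine (continuous_expUnit.tendsto _).comp ((ht.smul hlim).congr fun k => ?_)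
      simp only [Function.comp_apply]
      rw [smul_smul, mul_assoc, mul_inv_cancel₀ (hnorm _).ne', mul_one, Int.cast_smul_eq_zsmul]
    refine hM.mem_of_tendsto hmul (Eventually.of_forall fun k => ?_)
    rw [expUnit_zsmul]
    exact zpow_mem (hxM _) _
  have h0 : X = 0 := Submodule.disjoint_def.1 hVC X hXV hXC
  rw [mem_sphere_zero_iff_norm, h0, norm_zero] at hX
  exact zero_ne_one hX

/-- Canonical coordinates of the second kind adapted to a closed subgroup `M` whose one-parameter
subgroups are those of the subspace `V`: the chart is `X ↦ exp (X - p X) * exp (p X)` for a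
projection `p` onto `V`, and in it `M` is the subspace `V`. -/
theorem exists_chart_adapted {M : Subgroup Eˣ} (hM : IsClosed (M : Set Eˣ))
    {V : Submodule ℝ E} (hV : ∀ X, X ∈ V ↔ ∀ t : ℝ, expUnit (t • X) ∈ M) :
    ∃ (p : E →L[ℝ] E) (Ψ : OpenPartialHomeomorph E E), 0 ∈ Ψ.source ∧
      (∀ X, Ψ X = expUnit (X - p X) * expUnit (p X)) ∧
      (∀ X, p X ∈ V) ∧ (∀ X ∈ V, p X = X) ∧
      ∀ᶠ h : Eˣ in 𝓝 1, h ∈ M → (h : E) ∈ Ψ.target ∧ Ψ.symm h ∈ V := by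
  obtain ⟨C, hC⟩ := V.exists_isCompl
  let p : E →L[ℝ] E := LinearMap.toContinuousLinearMap (V.projection C hC)
  have hpV : ∀ X, p X ∈ V := fun X => Submodule.projection_apply_mem hC X
  have hp : ∀ X ∈ V, p X = X := fun X hX => Submodule.projection_apply_left hC ⟨X, hX⟩
  have hpC : ∀ X, X - p X ∈ C := fun X => Submodule.sub_projection_mem hC X
  let Φ : E → E := fun X => NormedSpace.exp (X - p X) * NormedSpace.exp (p X)
  have hderiv : HasStrictFDerivAt Φ ((ContinuousLinearEquiv.refl ℝ E : E ≃L[ℝ] E) : E →L[ℝ] E)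
      0 := by
    have h1 : HasStrictFDerivAt (fun X : E => NormedSpace.exp (X - p X))
        ((1 : E →L[ℝ] E).comp (ContinuousLinearMap.id ℝ E - p)) 0 := by
      refine HasStrictFDerivAt.comp (g := NormedSpace.exp) 0 ?_
        ((hasStrictFDerivAt_id _).sub p.hasStrictFDerivAt)
      simpa using hasStrictFDerivAt_exp_zero (𝕂 := ℝ) (𝔸 := E)
    have h2 : HasStrictFDerivAt (fun X : E => NormedSpace.exp (p X))
        ((1 : E →L[ℝ] E).comp p) 0 := by
      refine HasStrictFDerivAt.comp (g := NormedSpace.exp) 0 ?_ p.hasStrictFDerivAt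
      simpa using hasStrictFDerivAt_exp_zero (𝕂 := ℝ) (𝔸 := E)
    refine (h1.mul' h2).congr_fderiv ?_
    ext X
    simp
  let Ψ := hderiv.toOpenPartialHomeomorph Φ
  have hΨ : ∀ X, Ψ X = Φ X := fun X => rfl
  have h0 : (0 : E) ∈ Ψ.source := hderiv.mem_toOpenPartialHomeomorph_source
  have hΦ0 : Φ 0 = 1 := by simp [Φ]
  have h1 : (1 : E) ∈ Ψ.target := by
    rw [← hΦ0, ← hΨ]
    exact Ψ.map_source h0
  have hs1 : Ψ.symm 1 = 0 := by
    rw [← hΦ0, ← hΨ]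
    exact Ψ.left_inv h0
  refine ⟨p, Ψ, h0, fun X => rfl, hpV, hp, ?_⟩
  have hval : Tendsto (fun h : Eˣ => (h : E)) (𝓝 1) (𝓝 1) := Units.continuous_val.tendsto' _ _ rfl
  have hsymm : Tendsto (fun h : Eˣ => Ψ.symm (h : E)) (𝓝 1) (𝓝 0) := by
    have := (Ψ.continuousAt_symm h1).tendsto.comp hval
    rwa [hs1] at this
  have hq : Tendsto (fun X : E => X - p X) (𝓝 0) (𝓝 0) :=
    (continuous_id.sub p.continuous).tendsto' _ _ (by simp)
  filter_upwards [hval.eventually (Ψ.open_target.mem_nhds h1), (hq.comp hsymm).eventually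
    (eventually_expUnit_mem_imp_eq_zero hM (fun X => (hV X).2) hC.disjoint)] with h ht hh hhM
  refine ⟨ht, ?_⟩
  set Y := Ψ.symm (h : E) with hY
  have hmul : h = expUnit (Y - p Y) * expUnit (p Y) := by
    ext
    exact (Ψ.right_inv ht).symm
  have hmem : expUnit (Y - p Y) ∈ M := by
    rw [eq_mul_inv_of_mul_eq hmul.symm]
    refine mul_mem hhM (inv_mem ?_)
    simpa using (hV _).1 (hpV Y) 1
  have := hh (hpC Y) hmem
  simp only [Function.comp_apply] at this
  rw [← hY, sub_eq_zero] at this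
  rw [this]
  exact hpV Y

theorem eventually_mem_imp_exists_expUnit {M : Subgroup Eˣ} (hM : IsClosed (M : Set Eˣ))
    {V : Submodule ℝ E} (hV : ∀ X, X ∈ V ↔ ∀ t : ℝ, expUnit (t • X) ∈ M) :
    ∀ᶠ h : Eˣ in 𝓝 1, h ∈ M → ∃ Y ∈ V, h = expUnit Y := by
  obtain ⟨p, Ψ, -, hΨ, -, hp, hev⟩ := exists_chart_adapted hM hV
  filter_upwards [hev] with h hh hhM
  obtain ⟨ht, hY⟩ := hh hhM
  refine ⟨_, hY, ?_⟩
  ext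
  have h1 := Ψ.right_inv ht
  rw [hΨ, hp _ hY, sub_self, expUnit_zero, Units.val_one, one_mul] at h1
  exact h1.symm

/-- In adapted coordinates the transverse part of a unit `u` depends only on the coset `u T`, and
its exponential is the chosen point of this coset. -/
theorem hasLocalSection_of_expUnit_mem {M : Subgroup Eˣ} (hM : IsClosed (M : Set Eˣ))
    {V : Submodule ℝ E} (hV : ∀ X, X ∈ V ↔ ∀ t : ℝ, expUnit (t • X) ∈ M) {T : Subgroup Eˣ}
    (hTM : T ≤ M) (hVT : ∀ X ∈ V, expUnit X ∈ T) : HasLocalSection T := by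
  obtain ⟨p, Ψ, h0, hΨ, hpV, hp, hev⟩ := exists_chart_adapted hM hV
  have hΨ0 : Ψ 0 = 1 := by simp [hΨ]
  have h1 : (1 : E) ∈ Ψ.target := hΨ0 ▸ Ψ.map_source h0
  have hs1 : Ψ.symm 1 = 0 := by rw [← hΨ0, Ψ.left_inv h0]
  let c : Eˣ → E := fun u => Ψ.symm u - p (Ψ.symm u)
  have hpc : ∀ u, p (c u) = 0 := fun u => by
    simp only [c]
    rw [map_sub, hp _ (hpV _), sub_self]
  have hval : Tendsto (fun h : Eˣ => (h : E)) (𝓝 1) (𝓝 1) := Units.continuous_val.tendsto' _ _ rfl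
  have hsymm : Tendsto (fun h : Eˣ => Ψ.symm (h : E)) (𝓝 1) (𝓝 0) := by
    have := (Ψ.continuousAt_symm h1).tendsto.comp hval
    rwa [hs1] at this
  have hc : Tendsto c (𝓝 1) (𝓝 0) := by
    have hq : Tendsto (fun X : E => X - p X) (𝓝 0) (𝓝 0) :=
      (continuous_id.sub p.continuous).tendsto' _ _ (by simp)
    exact hq.comp hsymm
  let s : Eˣ → Eˣ := fun u => expUnit (c u)
  have hs : Tendsto s (𝓝 1) (𝓝 1) := by
    have := (continuous_expUnit (E := E)).tendsto 0
    rw [expUnit_zero] at this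
    exact this.comp hc
  have hdiv : Tendsto (fun w : Eˣ × Eˣ => (s w.1)⁻¹ * s w.2) (𝓝 1 ×ˢ 𝓝 1) (𝓝 1) := by
    simpa using (hs.comp tendsto_fst).inv.mul (hs.comp tendsto_snd)
  have hZ : Tendsto (fun w : Eˣ × Eˣ => c w.1 + Ψ.symm (((s w.1)⁻¹ * s w.2 : Eˣ) : E))
      (𝓝 1 ×ˢ 𝓝 1) (𝓝 0) := by
    simpa using (hc.comp tendsto_fst).add (hsymm.comp hdiv)
  have hsource : Ψ.source ∈ 𝓝 (0 : E) := Ψ.open_source.mem_nhds h0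
  obtain ⟨U₀, hU₀, hUU⟩ := (eventually_prod_self_iff (r := fun u v : Eˣ =>
      ((s u)⁻¹ * s v ∈ M → (((s u)⁻¹ * s v : Eˣ) : E) ∈ Ψ.target ∧
        Ψ.symm (((s u)⁻¹ * s v : Eˣ) : E) ∈ V) ∧
      c u + Ψ.symm (((s u)⁻¹ * s v : Eˣ) : E) ∈ Ψ.source)).1
    ((hdiv.eventually hev).and (hZ.eventually hsource))
  have hU₁ : U₀ ∩ (fun u : Eˣ => (u : E)) ⁻¹' Ψ.target ∩ c ⁻¹' Ψ.source ∈ 𝓝 (1 : Eˣ) :=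
    inter_mem (inter_mem hU₀ (hval (Ψ.open_target.mem_nhds h1))) (hc hsource)
  obtain ⟨U, hU, hUo, h1U⟩ := mem_nhds_iff.1 hU₁
  have hsu : ∀ u ∈ U, (s u)⁻¹ * u = expUnit (p (Ψ.symm (u : E))) := by
    intro u hu
    rw [inv_mul_eq_iff_eq_mul]
    ext
    rw [Units.val_mul]
    exact (Ψ.right_inv (hU hu).1.2).symm.trans (hΨ _)
  refine ⟨U, hUo, h1U, s, ?_, fun u hu => ?_, fun u hu v hv huv => ?_⟩
  · refine continuous_expUnit.comp_continuousOn ?_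
    have : ContinuousOn (fun u : Eˣ => Ψ.symm (u : E)) U :=
      Ψ.continuousOn_symm.comp Units.continuous_val.continuousOn fun u hu => (hU hu).1.2
    exact this.sub (p.continuous.comp_continuousOn this)
  · rw [hsu u hu]
    exact hVT _ (hpV _)
  · have hmem : (s u)⁻¹ * s v ∈ M := by
      have hu' : (s u)⁻¹ * u ∈ T := hsu u hu ▸ hVT _ (hpV _)
      have hv' : (s v)⁻¹ * v ∈ T := hsu v hv ▸ hVT _ (hpV _)
      have := mul_mem (mul_mem hu' huv) (inv_mem hv')
      refine hTM ?_
      simpa [mul_assoc] using this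
    obtain ⟨himp, hZs⟩ := hUU u (hU hu).1.1 v (hU hv).1.1
    obtain ⟨ht, hY⟩ := himp hmem
    set Y := Ψ.symm (((s u)⁻¹ * s v : Eˣ) : E) with hYdef
    have hYe : expUnit Y = (s u)⁻¹ * s v := by
      ext
      have h2 := Ψ.right_inv ht
      rw [← hYdef, hΨ, hp _ hY, sub_self, expUnit_zero, Units.val_one, one_mul] at h2
      exact h2
    have hpZ : p (c u + Y) = Y := by rw [map_add, hpc, hp _ hY, zero_add]
    -- Both `c u + Y` and `c v` are coordinates of `s v`.
    have heq : Ψ (c u + Y) = Ψ (c v) := by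
      rw [hΨ, hΨ, hpZ, hpc, add_sub_cancel_right, sub_zero, expUnit_zero, Units.val_one, mul_one,
        hYe, ← Units.val_mul]
      change ((s u * ((s u)⁻¹ * s v) : Eˣ) : E) = s v
      rw [mul_inv_cancel_left]
    have h3 := Ψ.injOn hZs (hU hv).2 heq
    have hY0 : Y = 0 := by rw [← hpZ, h3, hpc]
    simp only [s]
    rw [← h3, hY0, add_zero]

end Exp

/-! ### One-parameter subgroups of algebraic groups -/

section Algebraic

open Topology Filter
open scoped Matrix.Norms.Operator

/-- A family of entire functions stable under differentiation whose members vanish at `0`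
vanishes identically, by Taylor expansion. -/
theorem eq_zero_of_hasDerivAt_family {ι : Type*} {f : ι → ℂ → ℂ} {D : ι → ι} {S : Set ι}
    (hD : ∀ i ∈ S, D i ∈ S) (hf : ∀ i z, HasDerivAt (f i) (f (D i) z) z)
    (h0 : ∀ i ∈ S, f i 0 = 0) {i : ι} (hi : i ∈ S) (z : ℂ) : f i z = 0 := by
  have hder : ∀ (k : ℕ) (i : ι), i ∈ S → iteratedDeriv k (f i) 0 = 0 := by
    intro k
    induction k with
    | zero => intro i hi; rw [iteratedDeriv_zero, h0 i hi]
    | succ k ih =>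
      intro i hi
      have : deriv (f i) = f (D i) := funext fun z => (hf i z).deriv
      rw [iteratedDeriv_succ', this]
      exact ih _ (hD i hi)
  have hd : Differentiable ℂ (f i) := fun z => (hf i z).differentiableAt
  rw [← Complex.taylorSeries_eq_of_entire hd 0 z]
  simp [hder _ i hi]

variable {n : ℕ}

theorem hasDerivAt_evalAt_exp (X : Matrix (Fin n) (Fin n) ℂ)
    (p : MvPolynomial (Fin n × Fin n) ℂ) (z : ℂ) :
    HasDerivAt (fun z : ℂ => evalAt (NormedSpace.exp (z • X)) p)
      (evalAt (NormedSpace.exp (z • X)) (invDer X p)) z := by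
  induction p using MvPolynomial.induction_on with
  | C a =>
    simpa [evalAt, ← MvPolynomial.algebraMap_eq] using hasDerivAt_const z a
  | add p q hp hq =>
    simp only [evalAt, map_add] at hp hq ⊢
    exact hp.add hq
  | mul_X p ij hp =>
    obtain ⟨i, j⟩ := ij
    have hX : HasDerivAt (fun z : ℂ => NormedSpace.exp (z • X) i j)
        ((NormedSpace.exp (z • X) * X) i j) z :=
      (LinearMap.toContinuousLinearMap
        (Matrix.entryLinearMap ℂ ℂ i j)).hasFDerivAt.comp_hasDerivAt z
          (hasDerivAt_exp_smul_const X z)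
    have := hp.mul hX
    rw [Derivation.leibniz, invDer_X]
    simp only [evalAt, map_mul, map_add, map_sum, MvPolynomial.eval_X, MvPolynomial.eval_C,
      smul_eq_mul] at this ⊢
    refine this.congr_deriv ?_
    rw [Matrix.mul_apply, add_comm]
    congr 1
    · congr 1
      exact Finset.sum_congr rfl fun _ _ => mul_comm _ _
    · exact mul_comm _ _

theorem IsAlgebraic.mem_iff {G : Subgroup (GL (Fin n) ℂ)} (hG : IsAlgebraic G)
    (g : GL (Fin n) ℂ) :
    g ∈ G ↔ ∀ p, Vanishes G p → evalAt (g : Matrix (Fin n) (Fin n) ℂ) p = 0 := by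
  obtain ⟨S, hS⟩ := hG
  refine ⟨fun hg p hp => hp g hg, fun h => (hS g).2 fun p hp => h p fun a ha => ?_⟩
  exact (hS a).1 ha p hp

theorem continuous_evalAt (p : MvPolynomial (Fin n × Fin n) ℂ) :
    Continuous fun A : Matrix (Fin n) (Fin n) ℂ => evalAt A p := by
  unfold evalAt
  exact (MvPolynomial.continuous_eval p).comp
    (continuous_pi fun ij => continuous_id.matrix_elem ij.1 ij.2)

theorem IsAlgebraic.isClosed {G : Subgroup (GL (Fin n) ℂ)} (hG : IsAlgebraic G) :
    IsClosed (G : Set (GL (Fin n) ℂ)) := by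
  obtain ⟨S, hS⟩ := hG
  have : (G : Set (GL (Fin n) ℂ)) =
      ⋂ p ∈ S, {g : GL (Fin n) ℂ | evalAt (g : Matrix (Fin n) (Fin n) ℂ) p = 0} := by
    ext g
    simp [hS]
  rw [this]
  exact isClosed_biInter fun p _ =>
    isClosed_eq ((continuous_evalAt p).comp Units.continuous_val) continuous_const

/-- A tangent vector of an algebraic group exponentiates into the group. -/
theorem expUnit_mem_of_mem_lieAlgebra {G : Subgroup (GL (Fin n) ℂ)} (hG : IsAlgebraic G)
    {X : Matrix (Fin n) (Fin n) ℂ} (hX : X ∈ lieAlgebra G) : expUnit X ∈ G := by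
  rw [hG.mem_iff]
  intro p hp
  have := eq_zero_of_hasDerivAt_family (S := {p | Vanishes G p}) (D := invDer X)
    (fun p hp => vanishes_invDer hX hp) (hasDerivAt_evalAt_exp X)
    (fun p hp => by simpa using hp 1 G.one_mem) hp 1
  rw [one_smul] at this
  exact this

/-- A one-parameter subgroup of `G` has its generator in the tangent space at the identity. -/
theorem mem_lieAlgebra_of_expUnit_mem {G : Subgroup (GL (Fin n) ℂ)}
    {X : Matrix (Fin n) (Fin n) ℂ} (hX : ∀ t : ℝ, expUnit (t • X) ∈ G) : X ∈ lieAlgebra G := by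
  intro p hp
  have h1 : HasDerivAt (fun t : ℝ => evalAt (NormedSpace.exp ((t : ℂ) • X)) p)
      (evalAt (NormedSpace.exp (((0 : ℝ) : ℂ) • X)) (invDer X p)) 0 :=
    (hasDerivAt_evalAt_exp X p _).comp_ofReal
  have h2 : (fun t : ℝ => evalAt (NormedSpace.exp ((t : ℂ) • X)) p) = fun _ => 0 := by
    ext t
    have := hp _ (hX t)
    rwa [val_expUnit, ← Complex.coe_smul] at this
  rw [h2] at h1
  have h3 := h1.unique (hasDerivAt_const (0 : ℝ) (0 : ℂ))
  rw [diffOne_eq]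
  simpa using h3

theorem hasDerivAt_exp_conj (φ : Matrix (Fin n) (Fin n) ℂ →ₗ[ℂ] ℂ)
    (X Y : Matrix (Fin n) (Fin n) ℂ) (z : ℂ) :
    HasDerivAt (fun z : ℂ => φ (NormedSpace.exp (z • X) * Y * NormedSpace.exp (-(z • X))))
      (φ (NormedSpace.exp (z • X) * (X * Y - Y * X) * NormedSpace.exp (-(z • X)))) z := by
  have h1 := hasDerivAt_exp_smul_const X z
  have h2 : HasDerivAt (fun z : ℂ => NormedSpace.exp (-(z • X)))
      (-X * NormedSpace.exp (-(z • X))) z := by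
    have h := hasDerivAt_exp_smul_const' (-X) z
    simp only [smul_neg] at h
    exact h
  have h3 := (h1.mul_const Y).mul h2
  refine ((LinearMap.toContinuousLinearMap φ).hasFDerivAt.comp_hasDerivAt z h3).congr_deriv ?_
  change φ _ = φ _
  congr 1
  noncomm_ring

theorem mem_of_forall_dual {W : Submodule ℂ (Matrix (Fin n) (Fin n) ℂ)}
    {Y : Matrix (Fin n) (Fin n) ℂ}
    (h : ∀ φ : Matrix (Fin n) (Fin n) ℂ →ₗ[ℂ] ℂ, (∀ Z ∈ W, φ Z = 0) → φ Y = 0) : Y ∈ W := by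
  by_contra hY
  obtain ⟨φ, hφ, hW⟩ := Submodule.exists_le_ker_of_notMem hY
  exact hφ (h φ fun Z hZ => hW hZ)

/-- If `ad X` preserves a subspace, so does `Ad (exp X)`. -/
theorem expUnit_conj_mem {W : Submodule ℂ (Matrix (Fin n) (Fin n) ℂ)}
    {X : Matrix (Fin n) (Fin n) ℂ} (hX : ∀ Y ∈ W, X * Y - Y * X ∈ W) {Y : Matrix (Fin n) (Fin n) ℂ}
    (hY : Y ∈ W) : (expUnit X).val * Y * (expUnit X)⁻¹.val ∈ W := by
  refine mem_of_forall_dual fun φ hφ => ?_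
  have := eq_zero_of_hasDerivAt_family (S := {Y | Y ∈ W}) (D := fun Y => X * Y - Y * X)
    (fun Y hY => hX Y hY) (hasDerivAt_exp_conj φ X) (fun Y hY => by simpa using hφ Y hY) hY 1
  simp only [one_smul] at this
  rw [← expUnit_neg]
  exact this

/-- If `Ad (exp (t X))` preserves a subspace for all real `t`, so does `ad X`. -/
theorem lie_mem_of_expUnit_conj_mem {W : Submodule ℂ (Matrix (Fin n) (Fin n) ℂ)}
    {X Y : Matrix (Fin n) (Fin n) ℂ}
    (h : ∀ t : ℝ, (expUnit (t • X)).val * Y * (expUnit (t • X))⁻¹.val ∈ W) :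
    X * Y - Y * X ∈ W := by
  refine mem_of_forall_dual fun φ hφ => ?_
  have h1 : HasDerivAt (fun t : ℝ => φ (NormedSpace.exp ((t : ℂ) • X) * Y *
      NormedSpace.exp (-((t : ℂ) • X)))) _ 0 := (hasDerivAt_exp_conj φ X Y _).comp_ofReal
  have h2 : (fun t : ℝ => φ (NormedSpace.exp ((t : ℂ) • X) * Y *
      NormedSpace.exp (-((t : ℂ) • X)))) = fun _ => 0 := by
    ext t
    have := hφ _ (h t)
    rw [← expUnit_neg, ← Complex.coe_smul] at this
    exact this
  rw [h2] at h1
  simpa using h1.unique (hasDerivAt_const (0 : ℝ) (0 : ℂ))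

/-- The normalizer in `G` of a space of matrices, for the adjoint action. -/
def adNormalizer (G : Subgroup (GL (Fin n) ℂ)) (W : Submodule ℂ (Matrix (Fin n) (Fin n) ℂ)) :
    Subgroup (GL (Fin n) ℂ) where
  carrier := {g | g ∈ G ∧ ∀ Y ∈ W, g.val * Y * g⁻¹.val ∈ W ∧
    g⁻¹.val * Y * g.val ∈ W}
  one_mem' := ⟨G.one_mem, fun Y hY => by simpa using hY⟩
  mul_mem' := by
    rintro g h ⟨hg, hgW⟩ ⟨hh, hhW⟩
    refine ⟨G.mul_mem hg hh, fun Y hY => ⟨?_, ?_⟩⟩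
    · have := (hgW _ (hhW Y hY).1).1
      rw [mul_inv_rev, Units.val_mul, Units.val_mul]
      simpa only [mul_assoc] using this
    · have := (hhW _ (hgW Y hY).2).2
      rw [mul_inv_rev, Units.val_mul, Units.val_mul]
      simpa only [mul_assoc] using this
  inv_mem' := by
    rintro g ⟨hg, hgW⟩
    refine ⟨G.inv_mem hg, fun Y hY => ?_⟩
    rw [inv_inv]
    exact (hgW Y hY).symm

theorem isClosed_adNormalizer {G : Subgroup (GL (Fin n) ℂ)} (hG : IsAlgebraic G)
    (W : Submodule ℂ (Matrix (Fin n) (Fin n) ℂ)) :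
    IsClosed (adNormalizer G W : Set (GL (Fin n) ℂ)) := by
  have hW : IsClosed (W : Set (Matrix (Fin n) (Fin n) ℂ)) := W.closed_of_finiteDimensional
  have : (adNormalizer G W : Set (GL (Fin n) ℂ)) = (G : Set (GL (Fin n) ℂ)) ∩ ⋂ Y ∈ W,
      ({g : GL (Fin n) ℂ | g.val * Y * g⁻¹.val ∈ W} ∩
        {g : GL (Fin n) ℂ | g⁻¹.val * Y * g.val ∈ W}) := by
    ext g
    simp [adNormalizer]
  rw [this]
  have hv : Continuous fun g : GL (Fin n) ℂ => (g : Matrix (Fin n) (Fin n) ℂ) :=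
    Units.continuous_val
  have hi : Continuous fun g : GL (Fin n) ℂ => (↑g⁻¹ : Matrix (Fin n) (Fin n) ℂ) :=
    Units.continuous_coe_inv
  exact hG.isClosed.inter <| isClosed_biInter fun Y _ =>
    (hW.preimage ((hv.mul continuous_const).mul hi)).inter
      (hW.preimage ((hi.mul continuous_const).mul hv))

/-! ### The group generated by the exponentials of a self-normalizing subalgebra -/

variable {G : Subgroup (GL (Fin n) ℂ)}

/-- The matrices belonging to a subalgebra of the Lie algebra of `G`. -/
noncomputable def matrixSpace (𝔱 : LieSubalgebra ℂ (lieAlgebra G)) :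
    Submodule ℂ (Matrix (Fin n) (Fin n) ℂ) :=
  𝔱.toSubmodule.map (lieAlgebra G).toSubmodule.subtype

theorem mem_matrixSpace {𝔱 : LieSubalgebra ℂ (lieAlgebra G)} {X : Matrix (Fin n) (Fin n) ℂ} :
    X ∈ matrixSpace 𝔱 ↔ ∃ h : X ∈ lieAlgebra G, (⟨X, h⟩ : lieAlgebra G) ∈ 𝔱 := by
  constructor
  · rintro ⟨Y, hY, rfl⟩
    exact ⟨Y.2, hY⟩
  · rintro ⟨h, hX⟩
    exact ⟨⟨X, h⟩, hX, rfl⟩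

theorem lie_mem_matrixSpace {𝔱 : LieSubalgebra ℂ (lieAlgebra G)}
    {X Y : Matrix (Fin n) (Fin n) ℂ} (hX : X ∈ matrixSpace 𝔱) (hY : Y ∈ matrixSpace 𝔱) :
    X * Y - Y * X ∈ matrixSpace 𝔱 := by
  obtain ⟨hX, hX'⟩ := mem_matrixSpace.1 hX
  obtain ⟨hY, hY'⟩ := mem_matrixSpace.1 hY
  have h : ((⁅(⟨X, hX⟩ : lieAlgebra G), (⟨Y, hY⟩ : lieAlgebra G)⁆ : lieAlgebra G) :
      Matrix (Fin n) (Fin n) ℂ) ∈ matrixSpace 𝔱 :=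
    mem_matrixSpace.2 ⟨Subtype.property _, 𝔱.lie_mem hX' hY'⟩
  rwa [LieSubalgebra.coe_bracket, Ring.lie_def] at h

/-- The Lie algebra of the normalizer of `𝔱` in `G` is `𝔱`, as `𝔱` is its own normalizer in the
Lie algebra of `G`. -/
theorem mem_matrixSpace_iff_expUnit_mem (hG : IsAlgebraic G)
    {𝔱 : LieSubalgebra ℂ (lieAlgebra G)} (h𝔱 : 𝔱.normalizer = 𝔱)
    (X : Matrix (Fin n) (Fin n) ℂ) :
    X ∈ matrixSpace 𝔱 ↔ ∀ t : ℝ, expUnit (t • X) ∈ adNormalizer G (matrixSpace 𝔱) := by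
  constructor
  · intro hX t
    have htX : t • X ∈ matrixSpace 𝔱 := by
      rw [← Complex.coe_smul]
      exact Submodule.smul_mem _ _ hX
    refine ⟨expUnit_mem_of_mem_lieAlgebra hG (mem_matrixSpace.1 htX).1, fun Y hY => ⟨?_, ?_⟩⟩
    · exact expUnit_conj_mem (fun Z hZ => lie_mem_matrixSpace htX hZ) hY
    · have := expUnit_conj_mem (fun Z hZ => lie_mem_matrixSpace (Submodule.neg_mem _ htX) hZ) hY
      rwa [expUnit_neg, inv_inv] at this
  · intro h
    have hX : X ∈ lieAlgebra G := mem_lieAlgebra_of_expUnit_mem fun t => (h t).1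
    refine mem_matrixSpace.2 ⟨hX, ?_⟩
    rw [← h𝔱, LieSubalgebra.mem_normalizer_iff]
    intro Y hY
    have := lie_mem_of_expUnit_conj_mem (W := matrixSpace 𝔱) (X := X) (Y := Y)
      (fun t => ((h t).2 Y (mem_matrixSpace.2 ⟨Y.2, hY⟩)).1)
    exact (mem_matrixSpace.1 this).2

theorem expUnit_mem_map_cartanTorus (hG : IsAlgebraic G) {𝔱 : LieSubalgebra ℂ (lieAlgebra G)}
    {X : Matrix (Fin n) (Fin n) ℂ} (hX : X ∈ matrixSpace 𝔱) :
    expUnit X ∈ (cartanTorus G 𝔱).map G.subtype := by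
  obtain ⟨h, hX'⟩ := mem_matrixSpace.1 hX
  exact ⟨⟨expUnit X, expUnit_mem_of_mem_lieAlgebra hG h⟩,
    Subgroup.subset_closure ⟨⟨X, h⟩, hX', rfl⟩, rfl⟩

theorem map_cartanTorus_le (hG : IsAlgebraic G) {𝔱 : LieSubalgebra ℂ (lieAlgebra G)}
    (h𝔱 : 𝔱.normalizer = 𝔱) :
    (cartanTorus G 𝔱).map G.subtype ≤ adNormalizer G (matrixSpace 𝔱) := by
  rw [Subgroup.map_le_iff_le_comap, cartanTorus, Subgroup.closure_le]
  rintro g ⟨X, hX, hgX⟩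
  have h1 : (g : GL (Fin n) ℂ) = expUnit (X : Matrix (Fin n) (Fin n) ℂ) := by
    ext1
    exact hgX
  have h2 := (mem_matrixSpace_iff_expUnit_mem hG h𝔱 X).1 (mem_matrixSpace.2 ⟨X.2, hX⟩) 1
  rw [one_smul, ← h1] at h2
  exact h2

/-- An element normalizing the group `T₀` generated by the exponentials of `𝔱` normalizes `𝔱`:
the one-parameter subgroups of `T₀` are those of the normalizer of `𝔱`, hence those of `𝔱`. -/
theorem mem_adNormalizer_of_mem_torusNormalizer (hG : IsAlgebraic G)
    {𝔱 : LieSubalgebra ℂ (lieAlgebra G)} (h𝔱 : 𝔱.normalizer = 𝔱) {g : G}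
    (hg : g ∈ torusNormalizer (cartanTorus G 𝔱)) :
    (g : GL (Fin n) ℂ) ∈ adNormalizer G (matrixSpace 𝔱) := by
  have key : ∀ a : G, a ∈ torusNormalizer (cartanTorus G 𝔱) → ∀ Y ∈ matrixSpace 𝔱,
      a.1.val * Y * a.1⁻¹.val ∈ matrixSpace 𝔱 := by
    intro a ha Y hY
    rw [mem_matrixSpace_iff_expUnit_mem hG h𝔱]
    intro t
    have htY : t • Y ∈ matrixSpace 𝔱 := by
      rw [← Complex.coe_smul]
      exact Submodule.smul_mem _ _ hY
    obtain ⟨b, hb, hbY⟩ := expUnit_mem_map_cartanTorus hG htY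
    have h1 : a * b * a⁻¹ ∈ cartanTorus G 𝔱 := (Subgroup.mem_normalizer_iff.1 ha b).1 hb
    have h2 := map_cartanTorus_le hG h𝔱 ⟨_, h1, rfl⟩
    have h3 : G.subtype (a * b * a⁻¹) =
        expUnit (t • (a.1.val * Y * a.1⁻¹.val)) := by
      rw [map_mul, map_mul, hbY, map_inv, Subgroup.subtype_apply, ← expUnit_conj]
      congr 1
      simp
    rwa [h3] at h2
  refine ⟨g.2, fun Y hY => ⟨key g hg Y hY, ?_⟩⟩
  have := key g⁻¹ (inv_mem hg) Y hY
  simpa using this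

theorem joined_one_cartanTorus (hG : IsAlgebraic G) {𝔱 : LieSubalgebra ℂ (lieAlgebra G)}
    (t : cartanTorus G 𝔱) : Joined 1 t := by
  obtain ⟨t, ht⟩ := t
  refine Subgroup.closure_induction
    (p := fun (g : G) hg => Joined 1 (⟨g, hg⟩ : cartanTorus G 𝔱)) ?_ (Joined.refl _) ?_ ?_ ht
  · rintro g ⟨X, hX, hgX⟩
    have hmem : ∀ s : ℝ, s • X ∈ 𝔱 := fun s => by
      have := 𝔱.smul_mem (s : ℂ) hX
      rwa [Complex.coe_smul] at this
    have hG' : ∀ s : ℝ, expUnit ((s • X : lieAlgebra G) : Matrix (Fin n) (Fin n) ℂ) ∈ G :=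
      fun s => expUnit_mem_of_mem_lieAlgebra hG (s • X).2
    let γ : unitInterval → cartanTorus G 𝔱 := fun s =>
      ⟨⟨expUnit (((s : ℝ) • X : lieAlgebra G) : Matrix (Fin n) (Fin n) ℂ), hG' s⟩,
        Subgroup.subset_closure ⟨_, hmem s, rfl⟩⟩
    have hγ : Continuous γ := by
      refine Continuous.subtype_mk (Continuous.subtype_mk (continuous_expUnit.comp ?_) _) _
      change Continuous fun s : unitInterval => (s : ℝ) • (X : Matrix (Fin n) (Fin n) ℂ)
      exact continuous_subtype_val.smul continuous_const
    refine ⟨⟨⟨γ, hγ⟩, ?_, ?_⟩⟩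
    · refine Subtype.ext (Subtype.ext ?_)
      simp [γ]
    · refine Subtype.ext (Subtype.ext (Units.ext ?_))
      simp only [γ, Set.Icc.coe_one, one_smul]
      exact hgX.symm
  · intro a b ha hb h1 h2
    have h3 := h1.mul h2
    rw [one_mul] at h3
    exact h3
  · intro a ha h1
    have h3 := h1.inv
    rw [inv_one] at h3
    exact h3

/-- Path lifting along `G → G ⧸ T₀`: lift in `GL_n(ℂ)`, where `T₀` has local cross-sections. Since
`T₀ ⊆ G`, the lift stays in `G`. -/
theorem exists_path_lift_cartanTorus (hG : IsAlgebraic G) {𝔱 : LieSubalgebra ℂ (lieAlgebra G)}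
    (h𝔱 : 𝔱.normalizer = 𝔱) (δ : C(unitInterval, G ⧸ cartanTorus G 𝔱))
    (h0 : δ 0 = QuotientGroup.mk 1) :
    ∃ γ : C(unitInterval, G), γ 0 = 1 ∧
      ∀ t, (QuotientGroup.mk (γ t) : G ⧸ cartanTorus G 𝔱) = δ t := by
  have hsec : HasLocalSection ((cartanTorus G 𝔱).map G.subtype) :=
    hasLocalSection_of_expUnit_mem (isClosed_adNormalizer hG (matrixSpace 𝔱))
      (V := (matrixSpace 𝔱).restrictScalars ℝ)
      (fun X => mem_matrixSpace_iff_expUnit_mem hG h𝔱 X) (map_cartanTorus_le hG h𝔱)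
      (fun X hX => expUnit_mem_map_cartanTorus hG hX)
  have hle : ∀ a b : G, QuotientGroup.leftRel (cartanTorus G 𝔱) a b →
      (QuotientGroup.mk (a : GL (Fin n) ℂ) :
        GL (Fin n) ℂ ⧸ (cartanTorus G 𝔱).map G.subtype) = QuotientGroup.mk (b : GL (Fin n) ℂ) := by
    intro a b hab
    rw [QuotientGroup.eq]
    exact ⟨_, QuotientGroup.leftRel_apply.1 hab, rfl⟩
  let ι : G ⧸ cartanTorus G 𝔱 → GL (Fin n) ℂ ⧸ (cartanTorus G 𝔱).map G.subtype :=
    Quotient.lift (fun a : G => QuotientGroup.mk (a : GL (Fin n) ℂ)) hle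
  have hι : Continuous ι :=
    (QuotientGroup.continuous_mk.comp continuous_subtype_val).quotient_lift hle
  have hιmk : ∀ a : G, ι (QuotientGroup.mk a) = QuotientGroup.mk (a : GL (Fin n) ℂ) :=
    fun _ => rfl
  obtain ⟨γ, γ0, hγ⟩ := hsec.exists_path_lift ((⟨ι, hι⟩ : C(_, _)).comp δ) 1 (by
    rw [ContinuousMap.comp_apply, h0]
    exact (hιmk 1).symm)
  have hmem : ∀ t, ∃ h : γ t ∈ G, (QuotientGroup.mk ⟨γ t, h⟩ : G ⧸ cartanTorus G 𝔱) = δ t := by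
    intro t
    obtain ⟨a, ha⟩ := QuotientGroup.mk_surjective (δ t)
    have h1 := hγ t
    rw [ContinuousMap.comp_apply, ← ha] at h1
    obtain ⟨b, hb, hbt⟩ := QuotientGroup.eq.1 (h1.trans (hιmk a))
    have h2 : γ t = (a : GL (Fin n) ℂ) * (b : GL (Fin n) ℂ)⁻¹ := by
      rw [← Subgroup.subtype_apply b, hbt]
      group
    have h3 : γ t ∈ G := h2 ▸ G.mul_mem a.2 (G.inv_mem b.2)
    refine ⟨h3, ?_⟩
    rw [← ha, QuotientGroup.eq]
    have h4 : (⟨γ t, h3⟩ : G)⁻¹ * a = b := Subtype.ext hbt.symm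
    exact h4 ▸ hb
  choose hγG hγm using hmem
  exact ⟨⟨fun t => ⟨γ t, hγG t⟩, γ.continuous.subtype_mk _⟩, Subtype.ext γ0, hγm⟩

/-- The Weyl group as a fundamental group, for the exponentials of any self-normalizing subalgebra
`𝔱`. Near the identity, the normalizer of `T₀` lies in that of `𝔱`, which there consists of
exponentials of elements of `𝔱`. -/
theorem exists_fundamentalGroup_mulEquiv_weylGroup (hG : IsAlgebraic G) [SimplyConnectedSpace G]
    {𝔱 : LieSubalgebra ℂ (lieAlgebra G)} (h𝔱 : 𝔱.normalizer = 𝔱) :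
    ∃ e : FundamentalGroup (G ⧸ torusNormalizer (cartanTorus G 𝔱))
          (QuotientGroup.mk (1 : G)) ≃* WeylGroup (cartanTorus G 𝔱),
      ∀ (δ : Path (QuotientGroup.mk (1 : G) : G ⧸ torusNormalizer (cartanTorus G 𝔱))
            (QuotientGroup.mk (1 : G)))
        (w : torusNormalizer (cartanTorus G 𝔱)) (γ : Path (1 : G) (w : G)),
        (∀ t, (QuotientGroup.mk (γ t) : G ⧸ torusNormalizer (cartanTorus G 𝔱)) = δ t) →
        e (FundamentalGroup.fromPath (Path.Homotopic.Quotient.mk δ)) = QuotientGroup.mk w := by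
  refine exists_fundamentalGroup_quotient_normalizer_mulEquiv (joined_one_cartanTorus hG) ?_
    (exists_path_lift_cartanTorus hG h𝔱)
  have hev := eventually_mem_imp_exists_expUnit (isClosed_adNormalizer hG (matrixSpace 𝔱))
    (V := (matrixSpace 𝔱).restrictScalars ℝ)
    (fun X => mem_matrixSpace_iff_expUnit_mem hG h𝔱 X)
  have hval : Tendsto (fun g : G => (g : GL (Fin n) ℂ)) (𝓝 1) (𝓝 1) :=
    continuous_subtype_val.tendsto' _ _ rfl
  filter_upwards [hval.eventually hev] with g hg hgN
  obtain ⟨Y, hY, hgY⟩ := hg (mem_adNormalizer_of_mem_torusNormalizer hG h𝔱 hgN)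
  obtain ⟨b, hb, hbY⟩ := expUnit_mem_map_cartanTorus hG hY
  have : g = b := Subtype.ext (hgY.trans hbY.symm)
  exact this ▸ hb

end Algebraic

/-! ### Simple connectedness of punctured spaces -/

section Punctured

open Topology unitInterval

variable {E : Type*} [NormedAddCommGroup E] [NormedSpace ℝ E]

/-- A path is uniformly approximated by polynomial paths with the same end points. -/
theorem exists_contDiff_approx {x y : E} (p : Path x y) {c : ℝ} (hc : 0 < c) :
    ∃ q : ℝ → E, ContDiff ℝ 1 q ∧ q 0 = x ∧ q 1 = y ∧ ∀ t : I, ‖q t - p t‖ < c := by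
  have h1 := Metric.tendsto_atTop.1 (bernsteinApproximation_uniform p.toContinuousMap) c hc
  obtain ⟨N, hN⟩ := h1
  let n := N + 1
  let q : ℝ → E := fun t => ∑ k : Fin (n + 1),
    ((n.choose k : ℝ) * t ^ (k : ℕ) * (1 - t) ^ (n - k : ℕ)) • p (bernstein.z k)
  have hq : ∀ t : I, q t = bernsteinApproximation n p.toContinuousMap t := by
    intro t
    rw [bernsteinApproximation.apply]
    exact Finset.sum_congr rfl fun k _ => by rw [bernstein_apply]; rfl
  refine ⟨q, ?_, ?_, ?_, fun t => ?_⟩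
  · exact ContDiff.sum fun k _ => ContDiff.smul (by fun_prop) contDiff_const
  · have := hq 0
    rw [bernsteinApproximation.apply_zero] at this
    simpa using this
  · have := hq 1
    rw [bernsteinApproximation.apply_one (Nat.succ_ne_zero N)] at this
    simpa using this
  · rw [hq t, ← dist_eq_norm]
    exact (ContinuousMap.dist_apply_le_dist (g := p.toContinuousMap) t).trans_lt
      (hN n (Nat.le_succ N))

theorem starConvex_compl_ray {v : E} (hv : v ≠ 0) :
    StarConvex ℝ v {y : E | ∀ r : ℝ, 0 ≤ r → y ≠ -(r • v)} := by
  intro y hy a b ha hb hab r hr heq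
  rcases hb.eq_or_lt with rfl | hb
  · have : (a + r) • v = 0 := by
      rw [add_smul, ← add_neg_eq_zero.2 heq, zero_smul]
      abel
    rcases smul_eq_zero.1 this with h | h
    · linarith
    · exact hv h
  · refine hy (b⁻¹ * (a + r)) (by positivity) ?_
    have : b • y = -((a + r) • v) := by
      rw [add_smul, neg_add, ← heq]
      abel
    rw [mul_smul, ← smul_neg, ← this, smul_smul, inv_mul_cancel₀ hb.ne', one_smul]

/-- The complement of the origin in a real vector space of dimension at least three is simply
connected: a loop can be made smooth, after which the cone over it has dimension at most two, so
that the loop lies in the star-shaped complement of a ray. -/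
theorem isSimplyConnected_compl_zero [FiniteDimensional ℝ E] (hE : 2 < Module.finrank ℝ E) :
    IsSimplyConnected ({0}ᶜ : Set E) := by
  rw [isSimplyConnected_iff_exists_homotopy_refl_forall_mem]
  refine ⟨isPathConnected_compl_singleton_of_one_lt_rank ?_ 0, fun x p hp => ?_⟩
  · rw [← Module.finrank_eq_rank]
    exact_mod_cast (by omega : 1 < Module.finrank ℝ E)
  obtain ⟨t₀, ht₀⟩ : ∃ t₀ : I, ∀ t : I, ‖p t₀‖ ≤ ‖p t‖ := by
    obtain ⟨t₀, -, h⟩ := isCompact_univ.exists_isMinOn Set.univ_nonempty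
      (f := fun t : I => ‖p t‖) (by fun_prop)
    exact ⟨t₀, fun t => h (Set.mem_univ t)⟩
  obtain ⟨q, hq, hq0, hq1, hqp⟩ := exists_contDiff_approx p (norm_pos_iff.2 (hp t₀))
  -- A point of the segment from `p t` to `q t` is closer to `p t` than the origin.
  have hseg : ∀ s t : I, p t + (s : ℝ) • (q t - p t) ≠ 0 := by
    intro s t h0
    have h1 : ‖p t‖ = (s : ℝ) * ‖q t - p t‖ := by
      have := congrArg norm (add_eq_zero_iff_eq_neg.1 h0)
      rwa [norm_neg, norm_smul, Real.norm_of_nonneg s.2.1] at this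
    have h2 := hqp t
    have h3 := ht₀ t
    have h4 : (s : ℝ) * ‖q t - p t‖ ≤ 1 * ‖q t - p t‖ :=
      mul_le_mul_of_nonneg_right s.2.2 (norm_nonneg _)
    linarith
  obtain ⟨v, hv⟩ : ∃ v : E, v ∉ Set.range fun z : ℝ × ℝ => z.1 • q z.2 := by
    have hd := ContDiff.dense_compl_range_of_finrank_lt_finrank
      (f := fun z : ℝ × ℝ => z.1 • q z.2) (contDiff_fst.smul (hq.comp contDiff_snd))
      (by simpa using hE)
    exact hd.nonempty
  have hv0 : v ≠ 0 := fun h => hv ⟨(0, 0), by simp [h]⟩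
  let S : Set E := {y : E | ∀ r : ℝ, 0 ≤ r → y ≠ -(r • v)}
  have hvS : v ∈ S := by
    intro r hr heq
    have : (1 + r) • v = 0 := by rw [add_smul, one_smul, add_eq_zero_iff_eq_neg]; exact heq
    rcases smul_eq_zero.1 this with h | h
    · linarith
    · exact hv0 h
  have hS : IsSimplyConnected S := by
    have : ContractibleSpace S := (starConvex_compl_ray hv0).contractibleSpace ⟨v, hvS⟩
    exact SimplyConnectedSpace.ofContractible S
  let q' : Path x x := ⟨⟨fun t : I => q t, by have := hq.continuous; fun_prop⟩, hq0, hq1⟩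
  have hq'S : ∀ t, q' t ∈ S := by
    intro t r hr heq
    change q t = _ at heq
    rcases hr.eq_or_lt with rfl | hr
    · refine hseg 1 t ?_
      simp [heq]
    · refine hv ⟨(-r⁻¹, t), ?_⟩
      simp only
      rw [heq, smul_neg, neg_smul, neg_neg, smul_smul, inv_mul_cancel₀ hr.ne', one_smul]
  obtain ⟨F, hF⟩ := (isSimplyConnected_iff_exists_homotopy_refl_forall_mem.1 hS).2 x q' hq'S
  let H : p.Homotopy q' :=
    { toFun := fun z => p z.2 + (z.1 : ℝ) • (q z.2 - p z.2)
      continuous_toFun := by have := hq.continuous; fun_prop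
      map_zero_left := fun t => by simp
      map_one_left := fun t => by simp [q']
      prop' := by
        rintro s t (rfl | rfl)
        · simp [hq0]
        · simp [hq1] }
  refine ⟨H.trans F, fun z => ?_⟩
  rw [Path.Homotopy.trans_apply]
  split_ifs
  · exact hseg _ _
  · intro h0
    exact hF _ 0 le_rfl (h0.trans (by simp))

end Punctured

/-! ### Simple connectedness of the special linear group -/

section SpecialLinear

open Topology unitInterval Matrix
open scoped ComplexOrder

variable {ι : Type*} [Fintype ι]

/-- The ratio of `y` to `x` along `x`: the component of `y` along `x` is `ratio x y • x`. -/
noncomputable def ratio (x y : ι → ℂ) : ℂ := (star x ⬝ᵥ y) / (star x ⬝ᵥ x)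

theorem re_star_dotProduct_self_pos {x : ι → ℂ} (hx : x ≠ 0) : 0 < (star x ⬝ᵥ x).re := by
  have := dotProduct_star_self_pos_iff.2 hx
  exact (Complex.lt_def.1 this).1

theorem star_dotProduct_self_eq_ofReal (x : ι → ℂ) :
    star x ⬝ᵥ x = ((star x ⬝ᵥ x).re : ℂ) := by
  have := dotProduct_star_self_nonneg x
  exact (Complex.ext rfl (by simpa using (Complex.le_def.1 this).2.symm))

theorem ratio_re_pos {x y : ι → ℂ} (hx : x ≠ 0) (hxy : 0 < (star x ⬝ᵥ y).re) :
    0 < (ratio x y).re := by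
  rw [ratio, star_dotProduct_self_eq_ofReal, Complex.div_ofReal_re]
  exact div_pos hxy (re_star_dotProduct_self_pos hx)

theorem star_dotProduct_self_ne_zero {x : ι → ℂ} (hx : x ≠ 0) : star x ⬝ᵥ x ≠ 0 := by
  intro h
  have := re_star_dotProduct_self_pos hx
  rw [h] at this
  exact lt_irrefl _ this

theorem ratio_ne_zero {x y : ι → ℂ} (hx : x ≠ 0) (hxy : 0 < (star x ⬝ᵥ y).re) :
    ratio x y ≠ 0 := by
  intro h
  have := ratio_re_pos hx hxy
  rw [h] at this
  exact lt_irrefl _ this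

variable [DecidableEq ι]

/-- The linear map sending `x` to `y` and acting as the scalar `c` on the orthogonal complement of
`x`. Here `c = (ratio x y) ^ (-1 / m)`, with `m` the dimension of this complement, is chosen so that
the determinant is `1`; the power is continuous as long as `ratio x y` has positive real part. -/
noncomputable def carry (x y : ι → ℂ) : Matrix ι ι ℂ :=
  (ratio x y) ^ (-((Fintype.card ι - 1 : ℕ) : ℂ)⁻¹) •
      (1 + vecMulVec (((ratio x y) ^ (-((Fintype.card ι - 1 : ℕ) : ℂ)⁻¹))⁻¹ • y - x)
        ((star x ⬝ᵥ x)⁻¹ • star x))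

theorem carry_mulVec {x y : ι → ℂ} (hx : x ≠ 0) (hxy : 0 < (star x ⬝ᵥ y).re) :
    carry x y *ᵥ x = y := by
  have hc : ratio x y ^ (-((Fintype.card ι - 1 : ℕ) : ℂ)⁻¹) ≠ 0 := by
    rw [Complex.cpow_ne_zero_iff]
    exact Or.inl (ratio_ne_zero hx hxy)
  rw [carry, smul_mulVec, add_mulVec, one_mulVec, vecMulVec_mulVec, smul_dotProduct,
    smul_eq_mul, inv_mul_cancel₀ (star_dotProduct_self_ne_zero hx)]
  simp [smul_smul, hc]

theorem det_carry {x y : ι → ℂ} (hι : 1 < Fintype.card ι) (hx : x ≠ 0)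
    (hxy : 0 < (star x ⬝ᵥ y).re) : (carry x y).det = 1 := by
  have hd := ratio_ne_zero hx hxy
  set c := ratio x y ^ (-((Fintype.card ι - 1 : ℕ) : ℂ)⁻¹) with hcdef
  have hc : c ≠ 0 := by
    rw [hcdef, Complex.cpow_ne_zero_iff]
    exact Or.inl hd
  have hm : ((Fintype.card ι - 1 : ℕ) : ℂ) ≠ 0 := by
    rw [Nat.cast_ne_zero]
    omega
  have hcm : c ^ (Fintype.card ι - 1) = (ratio x y)⁻¹ := by
    rw [hcdef, ← Complex.cpow_mul_nat, neg_mul, inv_mul_cancel₀ hm, Complex.cpow_neg_one]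
  have hcard : Fintype.card ι = (Fintype.card ι - 1) + 1 := by omega
  have hx0 := star_dotProduct_self_ne_zero hx
  rw [carry, det_smul, ← hcdef, vecMulVec_eq Unit,
    det_one_add_replicateCol_mul_replicateRow]
  rw [hcard, pow_succ, hcm, smul_dotProduct, dotProduct_sub, dotProduct_smul, smul_eq_mul,
    smul_eq_mul]
  have : star x ⬝ᵥ y = ratio x y * (star x ⬝ᵥ x) := by
    rw [ratio, div_mul_cancel₀ _ hx0]
  rw [this]
  field_simp
  ring

theorem carry_self {x : ι → ℂ} (hx : x ≠ 0) : carry x x = 1 := by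
  have : ratio x x = 1 := div_self (star_dotProduct_self_ne_zero hx)
  rw [carry, this, Complex.one_cpow]
  simp

theorem continuousAt_carry {x y : ι → ℂ} (hx : x ≠ 0) (hxy : 0 < (star x ⬝ᵥ y).re) :
    ContinuousAt (fun z : (ι → ℂ) × (ι → ℂ) => carry z.1 z.2) (x, y) := by
  have hx0 := star_dotProduct_self_ne_zero hx
  have h1 : Continuous fun z : (ι → ℂ) × (ι → ℂ) => star z.1 ⬝ᵥ z.2 := by fun_prop
  have h2 : Continuous fun z : (ι → ℂ) × (ι → ℂ) => star z.1 ⬝ᵥ z.1 := by fun_prop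
  have hr : ContinuousAt (fun z : (ι → ℂ) × (ι → ℂ) => ratio z.1 z.2) (x, y) :=
    h1.continuousAt.div h2.continuousAt hx0
  have hc : ContinuousAt (fun z : (ι → ℂ) × (ι → ℂ) =>
      ratio z.1 z.2 ^ (-((Fintype.card ι - 1 : ℕ) : ℂ)⁻¹)) (x, y) :=
    hr.cpow continuousAt_const (Or.inl (ratio_re_pos hx hxy))
  have hc0 : ratio x y ^ (-((Fintype.card ι - 1 : ℕ) : ℂ)⁻¹) ≠ 0 := by
    rw [Complex.cpow_ne_zero_iff]
    exact Or.inl (ratio_ne_zero hx hxy)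
  refine hc.smul (continuousAt_const.add ?_)
  have hu : ContinuousAt (fun z : (ι → ℂ) × (ι → ℂ) =>
      (ratio z.1 z.2 ^ (-((Fintype.card ι - 1 : ℕ) : ℂ)⁻¹))⁻¹ • z.2 - z.1) (x, y) :=
    ((hc.inv₀ hc0).smul continuousAt_snd).sub continuousAt_fst
  have hv : ContinuousAt (fun z : (ι → ℂ) × (ι → ℂ) => (star z.1 ⬝ᵥ z.1)⁻¹ • star z.1) (x, y) :=
    (h2.continuousAt.inv₀ hx0).smul continuous_fst.star.continuousAt
  have hvm : Continuous fun z : (ι → ℂ) × (ι → ℂ) => vecMulVec z.1 z.2 := by fun_prop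
  exact hvm.continuousAt.comp (hu.prodMk hv)

theorem continuous_specialLinear_mk {X : Type*} [TopologicalSpace X] {f : X → Matrix ι ι ℂ}
    (hf : Continuous f) (hdet : ∀ x, (f x).det = 1) :
    Continuous fun x => (⟨f x, hdet x⟩ : SpecialLinearGroup ι ℂ) :=
  hf.subtype_mk hdet

/-- Homotopy lifting along `SL(ι, ℂ) → ℂ^ι ∖ {0}`, `g ↦ g x`: a homotopy is cut into finitely many
steps so short that `carry` moves each point to the next. -/
theorem exists_specialLinear_lift (hι : 1 < Fintype.card ι) {K : Type*} [PseudoMetricSpace K]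
    [CompactSpace K] (F : C(I × K, ι → ℂ)) (hF : ∀ z, F z ≠ 0) :
    ∃ g : C(I × K, SpecialLinearGroup ι ℂ),
      (∀ s k, (g (s, k) : Matrix ι ι ℂ) *ᵥ F (0, k) = F (s, k)) ∧ (∀ k, g (0, k) = 1) ∧
      ∀ k, (∀ s, F (s, k) = F (0, k)) → ∀ s, g (s, k) = 1 := by
  rcases isEmpty_or_nonempty K with hK | hK
  · exact ⟨⟨fun _ => 1, continuous_const⟩, fun _ k => hK.elim k, fun k => hK.elim k,
      fun k => hK.elim k⟩
  let H : I × I × K → ℝ := fun z => (star (F (z.1, z.2.2)) ⬝ᵥ F (z.2.1, z.2.2)).re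
  have hH : Continuous H := by
    have h1 : Continuous fun z : (ι → ℂ) × (ι → ℂ) => (star z.1 ⬝ᵥ z.2).re :=
      Complex.continuous_re.comp (by fun_prop)
    exact h1.comp (by fun_prop : Continuous fun z : I × I × K =>
      (F (z.1, z.2.2), F (z.2.1, z.2.2)))
  obtain ⟨w, -, hw⟩ := isCompact_univ.exists_isMinOn Set.univ_nonempty
    (f := fun z : I × K => H (z.1, z.1, z.2)) (by fun_prop)
  have hw0 : 0 < H (w.1, w.1, w.2) := re_star_dotProduct_self_pos (hF _)
  obtain ⟨δ, hδ, hHδ⟩ := Metric.uniformContinuous_iff.1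
    (CompactSpace.uniformContinuous_of_continuous hH) _ hw0
  have hpos : ∀ s s' : I, ∀ k : K, dist s s' < δ → 0 < H (s, s', k) := by
    intro s s' k hs
    have h1 : dist (s, s', k) (s, s, k) < δ := by
      simpa [Prod.dist_eq, hδ, dist_comm] using hs
    have h2 := hHδ h1
    have h3 : H (w.1, w.1, w.2) ≤ H (s, s, k) := hw (Set.mem_univ (s, k))
    rw [Real.dist_eq, abs_lt] at h2
    linarith [h2.1]
  obtain ⟨N, hN⟩ := exists_nat_one_div_lt hδ
  let τ : ℕ → I := fun j => Set.projIcc 0 1 zero_le_one ((j : ℝ) / (N + 1))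
  have hN0 : (0 : ℝ) < N + 1 := by positivity
  have hτ : ∀ (j : ℕ) (s : I), dist (min s (τ j)) (min s (τ (j + 1))) < δ := by
    intro j s
    have h1 : ((j + 1 : ℕ) : ℝ) / (N + 1) = j / (N + 1) + 1 / (N + 1) := by
      push_cast
      rw [add_div]
    have h2 : (0 : ℝ) < 1 / (N + 1) := by positivity
    have hmin : ∀ a b : I, ((min a b : I) : ℝ) = min (a : ℝ) b :=
      fun a b => (Subtype.mono_coe _).map_min
    rw [Subtype.dist_eq, Real.dist_eq, hmin, hmin]
    simp only [τ, Set.coe_projIcc, h1]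
    generalize (j : ℝ) / (N + 1) = x
    generalize (1 : ℝ) / (N + 1) = ε at *
    rw [abs_lt]
    simp only [min_def, max_def]
    constructor <;> split_ifs <;> linarith
  suffices ∀ j : ℕ, ∃ g : C(I × K, SpecialLinearGroup ι ℂ),
      (∀ s k, (g (s, k) : Matrix ι ι ℂ) *ᵥ F (0, k) = F (min s (τ j), k)) ∧
      (∀ k, g (0, k) = 1) ∧ ∀ k, (∀ s, F (s, k) = F (0, k)) → ∀ s, g (s, k) = 1 by
    obtain ⟨g, hg, hg'⟩ := this (N + 1)
    have h1 : τ (N + 1) = 1 := by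
      refine Set.projIcc_of_right_le _ ?_
      push_cast
      rw [div_self hN0.ne']
    refine ⟨g, fun s k => ?_, hg'⟩
    rw [hg, h1, min_eq_left unitInterval.le_one']
  intro j
  induction j with
  | zero =>
    have h0 : τ 0 = 0 := Set.projIcc_of_le_left _ (by simp)
    refine ⟨⟨fun _ => 1, continuous_const⟩, fun s k => ?_, fun _ => rfl, fun _ _ _ => rfl⟩
    rw [h0, min_eq_right unitInterval.nonneg']
    exact one_mulVec _
  | succ j ih =>
    obtain ⟨g, hg, hg0, hg1⟩ := ih
    let a : I × K → (ι → ℂ) × (ι → ℂ) := fun z =>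
      (F (min z.1 (τ j), z.2), F (min z.1 (τ (j + 1)), z.2))
    have ha : Continuous a := by fun_prop
    have hre : ∀ z, 0 < (star (a z).1 ⬝ᵥ (a z).2).re := fun z =>
      hpos (min z.1 (τ j)) (min z.1 (τ (j + 1))) z.2 (hτ j z.1)
    have hane : ∀ z, (a z).1 ≠ 0 := fun z => hF _
    have hcont : Continuous fun z => carry (a z).1 (a z).2 := by
      clear_value a
      rw [continuous_iff_continuousAt]
      intro z
      exact ContinuousAt.comp (f := a) (g := fun w : (ι → ℂ) × (ι → ℂ) => carry w.1 w.2)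
        (continuousAt_carry (hane z) (hre z)) ha.continuousAt
    let b : C(I × K, SpecialLinearGroup ι ℂ) :=
      ⟨fun z => ⟨carry (a z).1 (a z).2, det_carry hι (hane z) (hre z)⟩,
        continuous_specialLinear_mk hcont _⟩
    have hb1 : ∀ z, (a z).1 = (a z).2 → b z = 1 := fun z hz => by
      refine Subtype.ext ?_
      change carry (a z).1 (a z).2 = 1
      rw [← hz, carry_self (hane z)]
    refine ⟨b * g, fun s k => ?_, fun k => ?_, fun k hk s => ?_⟩
    · change ((b (s, k) : Matrix ι ι ℂ) * (g (s, k) : Matrix ι ι ℂ)) *ᵥ _ = _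
      rw [← mulVec_mulVec, hg]
      exact carry_mulVec (hane (s, k)) (hre (s, k))
    · rw [ContinuousMap.mul_apply, hg0, mul_one]
      refine hb1 _ ?_
      simp only [a]
      rw [min_eq_left unitInterval.nonneg', min_eq_left unitInterval.nonneg']
    · rw [ContinuousMap.mul_apply, hg1 k hk, mul_one]
      refine hb1 _ ?_
      simp only [a]
      rw [hk, hk (min s (τ (j + 1)))]

end SpecialLinear

/-! ### The induction on the size of the matrices -/

section SpecialLinearInduction

open Topology unitInterval Matrix

theorem homotopic_of_continuous {X : Type*} [TopologicalSpace X] {x y : X} {p q : Path x y}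
    {H : I × I → X} (hH : Continuous H) (h0 : ∀ t, H (0, t) = p t) (h1 : ∀ t, H (1, t) = q t)
    (hx : ∀ s, H (s, 0) = x) (hy : ∀ s, H (s, 1) = y) : Path.Homotopic p q :=
  ⟨{ toFun := H
     continuous_toFun := hH
     map_zero_left := h0
     map_one_left := h1
     prop' := by
      rintro s t (rfl | rfl)
      · exact (hx s).trans p.source.symm
      · exact (hy s).trans p.target.symm }⟩

variable {ι : Type*} [Fintype ι]

theorem isSimplyConnected_compl_zero_sum [Nonempty ι] :
    IsSimplyConnected ({0}ᶜ : Set (Unit ⊕ ι → ℂ)) := by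
  refine isSimplyConnected_compl_zero ?_
  rw [Module.finrank_pi_fintype]
  have : 0 < Fintype.card ι := Fintype.card_pos
  simp only [Complex.finrank_real_complex, Finset.sum_const, Finset.card_univ,
    Fintype.card_sum, Fintype.card_unit, smul_eq_mul]
  omega

theorem one_lt_card_sum [Nonempty ι] : 1 < Fintype.card (Unit ⊕ ι) := by
  have : 0 < Fintype.card ι := Fintype.card_pos
  rw [Fintype.card_sum, Fintype.card_unit]
  omega

variable [DecidableEq ι]

/-- The block diagonal embedding of `SL(ι, ℂ)` as the lower right corner. -/
def cornerEmbedding (D : SpecialLinearGroup ι ℂ) : SpecialLinearGroup (Unit ⊕ ι) ℂ :=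
  ⟨fromBlocks 1 0 0 (D : Matrix ι ι ℂ), by
    rw [det_fromBlocks_zero₂₁, det_one, one_mul, D.det_coe]⟩

theorem continuous_cornerEmbedding :
    Continuous (cornerEmbedding : SpecialLinearGroup ι ℂ → SpecialLinearGroup (Unit ⊕ ι) ℂ) := by
  refine continuous_specialLinear_mk ?_ _
  exact continuous_const.matrix_fromBlocks continuous_const continuous_const continuous_subtype_val

theorem cornerEmbedding_one :
    cornerEmbedding (1 : SpecialLinearGroup ι ℂ) = 1 :=
  Subtype.ext fromBlocks_one

variable (ι) in
/-- The first basis vector. -/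
def firstVec : Unit ⊕ ι → ℂ := Pi.single (Sum.inl ()) 1

theorem eq_fromBlocks_of_mulVec_firstVec {M : Matrix (Unit ⊕ ι) (Unit ⊕ ι) ℂ}
    (h : M *ᵥ firstVec ι = firstVec ι) : M = fromBlocks 1 M.toBlocks₁₂ 0 M.toBlocks₂₂ := by
  have hcol : ∀ i, M i (Sum.inl ()) = firstVec ι i := by
    intro i
    rw [← h, firstVec, mulVec_single_one]
    rfl
  conv_lhs => rw [← fromBlocks_toBlocks M]
  congr 1
  · ext i j
    simp [toBlocks₁₁, hcol, firstVec]
  · ext i j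
    simp [toBlocks₂₁, hcol, firstVec]

theorem det_toBlocks₂₂_of_mulVec_firstVec {M : Matrix (Unit ⊕ ι) (Unit ⊕ ι) ℂ}
    (h : M *ᵥ firstVec ι = firstVec ι) : M.toBlocks₂₂.det = M.det := by
  conv_rhs => rw [eq_fromBlocks_of_mulVec_firstVec h, det_fromBlocks_zero₂₁, det_one, one_mul]

/-- The stabilizer of the first basis vector in `SL(1 + ι, ℂ)` retracts onto the corner
`SL(ι, ℂ)`, by shrinking the rest of the first row to zero. -/
theorem exists_retraction_to_corner {X : Type*} [TopologicalSpace X]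
    {f : X → SpecialLinearGroup (Unit ⊕ ι) ℂ} (hf : Continuous f)
    (hfix : ∀ x, (f x : Matrix (Unit ⊕ ι) (Unit ⊕ ι) ℂ) *ᵥ firstVec ι = firstVec ι) :
    ∃ (D : X → SpecialLinearGroup ι ℂ) (H : I × X → SpecialLinearGroup (Unit ⊕ ι) ℂ),
      Continuous D ∧ Continuous H ∧ (∀ x, H (0, x) = f x) ∧
      (∀ x, H (1, x) = cornerEmbedding (D x)) ∧
      ∀ x, f x = 1 → D x = 1 ∧ ∀ s, H (s, x) = 1 := by
  have hfc : Continuous fun x => (f x : Matrix (Unit ⊕ ι) (Unit ⊕ ι) ℂ) :=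
    continuous_subtype_val.comp hf
  have hB : Continuous fun x => (f x : Matrix (Unit ⊕ ι) (Unit ⊕ ι) ℂ).toBlocks₁₂ :=
    continuous_matrix fun i j => hfc.matrix_elem _ _
  have hD : Continuous fun x => (f x : Matrix (Unit ⊕ ι) (Unit ⊕ ι) ℂ).toBlocks₂₂ :=
    continuous_matrix fun i j => hfc.matrix_elem _ _
  have hdet : ∀ x, (f x : Matrix (Unit ⊕ ι) (Unit ⊕ ι) ℂ).toBlocks₂₂.det = 1 := fun x =>
    (det_toBlocks₂₂_of_mulVec_firstVec (hfix x)).trans (f x).det_coe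
  have hdetH : ∀ z : I × X, (fromBlocks 1
      ((1 - ((z.1 : ℝ) : ℂ)) • (f z.2 : Matrix (Unit ⊕ ι) (Unit ⊕ ι) ℂ).toBlocks₁₂) 0
      (f z.2 : Matrix (Unit ⊕ ι) (Unit ⊕ ι) ℂ).toBlocks₂₂).det = 1 := fun z => by
    rw [det_fromBlocks_zero₂₁, det_one, one_mul, hdet]
  refine ⟨fun x => ⟨_, hdet x⟩, fun z => ⟨_, hdetH z⟩, continuous_specialLinear_mk hD hdet,
    continuous_specialLinear_mk ?_ hdetH, fun x => ?_, fun x => ?_, fun x hx => ⟨?_, fun s => ?_⟩⟩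
  · refine continuous_const.matrix_fromBlocks ?_ continuous_const (hD.comp continuous_snd)
    have h1 : Continuous fun z : I × X => (1 - ((z.1 : ℝ) : ℂ)) := by fun_prop
    exact h1.smul (hB.comp continuous_snd)
  · refine Subtype.ext ?_
    have := eq_fromBlocks_of_mulVec_firstVec (hfix x)
    simp [← this]
  · refine Subtype.ext ?_
    simp [cornerEmbedding]
  · refine Subtype.ext ?_
    simp only [hx]
    change (1 : Matrix (Unit ⊕ ι) (Unit ⊕ ι) ℂ).toBlocks₂₂ = 1
    rw [← fromBlocks_one, toBlocks_fromBlocks₂₂]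
  · refine Subtype.ext ?_
    simp only [hx]
    change fromBlocks 1 (_ • (1 : Matrix (Unit ⊕ ι) (Unit ⊕ ι) ℂ).toBlocks₁₂) 0
      (1 : Matrix (Unit ⊕ ι) (Unit ⊕ ι) ℂ).toBlocks₂₂ = (1 : Matrix (Unit ⊕ ι) (Unit ⊕ ι) ℂ)
    rw [← fromBlocks_one, toBlocks_fromBlocks₂₂, toBlocks_fromBlocks₁₂, smul_zero]

theorem firstVec_ne_zero {κ : Type*} [DecidableEq κ] : firstVec κ ≠ 0 := by
  intro h
  have := congrFun h (Sum.inl ())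
  simp [firstVec] at this

theorem mulVec_firstVec_ne_zero (M : SpecialLinearGroup (Unit ⊕ ι) ℂ) :
    (M : Matrix (Unit ⊕ ι) (Unit ⊕ ι) ℂ) *ᵥ firstVec ι ≠ 0 := by
  intro h
  exact firstVec_ne_zero
    (Matrix.eq_zero_of_mulVec_eq_zero (by rw [M.det_coe]; exact one_ne_zero) h)

theorem pathConnectedSpace_specialLinearGroup_sum [Nonempty ι]
    [PathConnectedSpace (SpecialLinearGroup ι ℂ)] :
    PathConnectedSpace (SpecialLinearGroup (Unit ⊕ ι) ℂ) := by
  have key : ∀ M : SpecialLinearGroup (Unit ⊕ ι) ℂ, Joined M 1 := by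
    intro M
    have hpc := (isSimplyConnected_compl_zero_sum (ι := ι)).isPathConnected
    obtain ⟨γ, hγ⟩ := hpc.joinedIn _ (mulVec_firstVec_ne_zero M) (firstVec ι) firstVec_ne_zero
    obtain ⟨g, hg, hg0, -⟩ := exists_specialLinear_lift one_lt_card_sum
      (K := Unit) (γ.toContinuousMap.comp ⟨Prod.fst, continuous_fst⟩) (fun z => hγ z.1)
    have hfix : ((g (1, ()) * M : SpecialLinearGroup (Unit ⊕ ι) ℂ) :
        Matrix (Unit ⊕ ι) (Unit ⊕ ι) ℂ) *ᵥ firstVec ι = firstVec ι := by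
      have := hg 1 ()
      simp only [ContinuousMap.comp_apply, ContinuousMap.coe_mk, Path.coe_toContinuousMap,
        Path.source, Path.target] at this
      rw [mulVec_mulVec] at this
      exact this
    have h1 : Joined M (g (1, ()) * M) :=
      ⟨⟨⟨fun s => g (s, ()) * M, by fun_prop⟩, by simp [hg0], rfl⟩⟩
    obtain ⟨D, H, hD, hH, hH0, hH1, -⟩ := exists_retraction_to_corner (X := Unit)
      (f := fun _ => g (1, ()) * M) continuous_const (fun _ => hfix)
    have h2 : Joined (g (1, ()) * M) (cornerEmbedding (D ())) :=
      ⟨⟨⟨fun s => H (s, ()), by fun_prop⟩, hH0 (), hH1 ()⟩⟩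
    have h3 : Joined (cornerEmbedding (D ())) 1 := by
      rw [← cornerEmbedding_one]
      exact (PathConnectedSpace.joined (D ()) 1).map continuous_cornerEmbedding
    exact (h1.trans h2).trans h3
  exact ⟨⟨1⟩, fun M N => (key M).trans (key N).symm⟩

/-- A loop in `SL(1 + ι, ℂ)` moves the first basis vector along a contractible loop. Lifting the
contraction deforms it into the stabilizer of this vector, and then into `SL(ι, ℂ)`. -/
theorem simplyConnectedSpace_specialLinearGroup_sum [Nonempty ι]
    [SimplyConnectedSpace (SpecialLinearGroup ι ℂ)] :
    SimplyConnectedSpace (SpecialLinearGroup (Unit ⊕ ι) ℂ) := by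
  have := pathConnectedSpace_specialLinearGroup_sum (ι := ι)
  refine simplyConnectedSpace_of_loops_at 1 fun γ => ?_
  have hγc : Continuous fun t => (γ t : Matrix (Unit ⊕ ι) (Unit ⊕ ι) ℂ) *ᵥ firstVec ι := by
    have : Continuous fun t => (γ t : Matrix (Unit ⊕ ι) (Unit ⊕ ι) ℂ) :=
      continuous_subtype_val.comp γ.continuous
    fun_prop
  let p : Path (firstVec ι) (firstVec ι) :=
    ⟨⟨fun t => (γ t : Matrix (Unit ⊕ ι) (Unit ⊕ ι) ℂ) *ᵥ firstVec ι, hγc⟩, by simp, by simp⟩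
  obtain ⟨F, hF⟩ := (isSimplyConnected_iff_exists_homotopy_refl_forall_mem.1
    (isSimplyConnected_compl_zero_sum (ι := ι))).2 _ p fun t => mulVec_firstVec_ne_zero (γ t)
  obtain ⟨g, hg, hg0, hgc⟩ := exists_specialLinear_lift one_lt_card_sum
    (⟨F, F.continuous⟩ : C(I × I, Unit ⊕ ι → ℂ)) hF
  simp only [ContinuousMap.coe_mk] at hg hgc
  have hF0 : ∀ s, F (s, 0) = firstVec ι := fun s => F.source s
  have hF1 : ∀ s, F (s, 1) = firstVec ι := fun s => F.target s
  have hgs : ∀ s, g (s, 0) = 1 := hgc 0 fun s => by rw [hF0, hF0]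
  have hgt : ∀ s, g (s, 1) = 1 := hgc 1 fun s => by rw [hF1, hF1]
  have hG : Continuous fun z : I × I => g z * γ z.2 := by fun_prop
  -- The end of the lifted contraction: a loop in the stabilizer of the first basis vector.
  let γ₁ : Path (1 : SpecialLinearGroup (Unit ⊕ ι) ℂ) 1 :=
    ⟨⟨fun t => g (1, t) * γ t, by fun_prop⟩, by simp [hgs], by simp [hgt]⟩
  have hom₁ : Path.Homotopic γ γ₁ :=
    homotopic_of_continuous hG (fun t => by simp [hg0]) (fun t => rfl) (fun s => by simp [hgs])
      (fun s => by simp [hgt])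
  have hfix : ∀ t, (γ₁ t : Matrix (Unit ⊕ ι) (Unit ⊕ ι) ℂ) *ᵥ firstVec ι = firstVec ι := by
    intro t
    have h1 := hg 1 t
    have h2 : F (0, t) = (γ t : Matrix (Unit ⊕ ι) (Unit ⊕ ι) ℂ) *ᵥ firstVec ι := F.apply_zero t
    have h3 : F (1, t) = firstVec ι := F.apply_one t
    rw [h2, h3, mulVec_mulVec] at h1
    exact h1
  obtain ⟨D, H, hD, hH, hH0, hH1, hfix1⟩ := exists_retraction_to_corner γ₁.continuous hfix
  have hD0 : D 0 = 1 := (hfix1 0 γ₁.source).1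
  have hD1 : D 1 = 1 := (hfix1 1 γ₁.target).1
  let β : Path (1 : SpecialLinearGroup ι ℂ) 1 := ⟨⟨D, hD⟩, hD0, hD1⟩
  let γ₂ : Path (1 : SpecialLinearGroup (Unit ⊕ ι) ℂ) 1 :=
    ⟨⟨fun t => cornerEmbedding (D t), continuous_cornerEmbedding.comp hD⟩,
      by simp [hD0, cornerEmbedding_one], by simp [hD1, cornerEmbedding_one]⟩
  have hom₂ : Path.Homotopic γ₁ γ₂ :=
    homotopic_of_continuous hH hH0 hH1 (fun s => (hfix1 0 γ₁.source).2 s)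
      (fun s => (hfix1 1 γ₁.target).2 s)
  obtain ⟨B⟩ := SimplyConnectedSpace.paths_homotopic β (Path.refl 1)
  have hom₃ : Path.Homotopic γ₂ (Path.refl 1) :=
    homotopic_of_continuous (H := fun z => cornerEmbedding (B z))
      (continuous_cornerEmbedding.comp B.continuous)
      (fun t => congrArg cornerEmbedding (B.apply_zero t))
      (fun t => (congrArg cornerEmbedding (B.apply_one t)).trans cornerEmbedding_one)
      (fun s => (congrArg cornerEmbedding (B.source s)).trans cornerEmbedding_one)
      (fun s => (congrArg cornerEmbedding (B.target s)).trans cornerEmbedding_one)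
  exact (hom₁.trans hom₂).trans hom₃

theorem simplyConnectedSpace_specialLinearGroup_of_equiv {κ : Type*} [Fintype κ] [DecidableEq κ]
    (e : ι ≃ κ) [SimplyConnectedSpace (SpecialLinearGroup ι ℂ)] :
    SimplyConnectedSpace (SpecialLinearGroup κ ℂ) := by
  have hdet : ∀ M : SpecialLinearGroup κ ℂ, ((M : Matrix κ κ ℂ).submatrix e e).det = 1 :=
    fun M => (det_submatrix_equiv_self e _).trans M.det_coe
  have hdet' : ∀ M : SpecialLinearGroup ι ℂ,
      ((M : Matrix ι ι ℂ).submatrix e.symm e.symm).det = 1 :=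
    fun M => (det_submatrix_equiv_self e.symm _).trans M.det_coe
  let φ : SpecialLinearGroup κ ℂ ≃ₜ SpecialLinearGroup ι ℂ :=
    { toFun := fun M => ⟨(M : Matrix κ κ ℂ).submatrix e e, hdet M⟩
      invFun := fun M => ⟨(M : Matrix ι ι ℂ).submatrix e.symm e.symm, hdet' M⟩
      left_inv := fun M => Subtype.ext (by simp)
      right_inv := fun M => Subtype.ext (by simp)
      continuous_toFun := continuous_specialLinear_mk
        (continuous_subtype_val.matrix_submatrix _ _) hdet
      continuous_invFun := continuous_specialLinear_mk
        (continuous_subtype_val.matrix_submatrix _ _) hdet' }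
  exact φ.toHomotopyEquiv.simplyConnectedSpace

theorem simplyConnectedSpace_specialLinearGroup_fin (n : ℕ) :
    SimplyConnectedSpace (SpecialLinearGroup (Fin n) ℂ) := by
  have hsub : ∀ m : ℕ, Subsingleton (SpecialLinearGroup (Fin m) ℂ) →
      SimplyConnectedSpace (SpecialLinearGroup (Fin m) ℂ) := by
    intro m _
    have : Unique (SpecialLinearGroup (Fin m) ℂ) := uniqueOfSubsingleton 1
    have : ContractibleSpace (SpecialLinearGroup (Fin m) ℂ) := inferInstance
    exact SimplyConnectedSpace.ofContractible _
  induction n with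
  | zero => exact hsub 0 inferInstance
  | succ n ih =>
    rcases n with _ | n
    · refine hsub 1 ⟨fun M N => ?_⟩
      ext i j
      have hM := M.det_coe
      have hN := N.det_coe
      rw [det_fin_one] at hM hN
      rw [Subsingleton.elim i 0, Subsingleton.elim j 0, hM, hN]
    · have := simplyConnectedSpace_specialLinearGroup_sum (ι := Fin (n + 1))
      exact simplyConnectedSpace_specialLinearGroup_of_equiv
        (Fintype.equivOfCardEq (by simp; omega) : Unit ⊕ Fin (n + 1) ≃ Fin (n + 2))

theorem isAlgebraic_specialLinear (n : ℕ) : IsAlgebraic (specialLinear n) := by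
  refine ⟨{(mvPolynomialX (Fin n) (Fin n) ℂ).det - 1}, fun g => ?_⟩
  have h : evalAt (g : Matrix (Fin n) (Fin n) ℂ) ((mvPolynomialX (Fin n) (Fin n) ℂ).det - 1) =
      (g : Matrix (Fin n) (Fin n) ℂ).det - 1 := by
    rw [evalAt, map_sub, map_one, RingHom.map_det, mvPolynomialX_mapMatrix_eval]
  simp only [Set.mem_singleton_iff, forall_eq]
  rw [h, sub_eq_zero, specialLinear, MonoidHom.mem_ker, Units.ext_iff]
  rfl

theorem simplyConnectedSpace_specialLinear (n : ℕ) : SimplyConnectedSpace (specialLinear n) := by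
  have hrange : Set.range (SpecialLinearGroup.toGL : SpecialLinearGroup (Fin n) ℂ → GL (Fin n) ℂ) =
      (specialLinear n : Set (GL (Fin n) ℂ)) := SpecialLinearGroup.range_toGL
  let φ := (SpecialLinearGroup.isEmbedding_toGL (n := Fin n) (R := ℂ)).toHomeomorph.trans
    (Homeomorph.setCongr hrange)
  have := simplyConnectedSpace_specialLinearGroup_fin n
  exact φ.symm.toHomotopyEquiv.simplyConnectedSpace

end SpecialLinearInduction

end CartanTorus

theorem mainTheorem7 :
    (∀ (n : ℕ) (G : Subgroup (GL (Fin n) ℂ)), CartanTorus.IsAlgebraic G →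
      ConnectedSpace G → SimplyConnectedSpace G →
      ∀ 𝔱 : LieSubalgebra ℂ (CartanTorus.lieAlgebra G), 𝔱.IsCartanSubalgebra →
      ∀ T₀ : Subgroup G, T₀ = CartanTorus.cartanTorus G 𝔱 →
      ∃ e : FundamentalGroup (G ⧸ CartanTorus.torusNormalizer T₀)
            (QuotientGroup.mk (1 : G)) ≃* CartanTorus.WeylGroup T₀,
        -- `e` sends a loop that lifts to a path in `G` from `1` to `w` to the class of `w`
        ∀ (δ : Path (QuotientGroup.mk (1 : G) : G ⧸ CartanTorus.torusNormalizer T₀)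
              (QuotientGroup.mk (1 : G)))
          (w : CartanTorus.torusNormalizer T₀) (γ : Path (1 : G) (w : G)),
          (∀ t, (QuotientGroup.mk (γ t) : G ⧸ CartanTorus.torusNormalizer T₀) = δ t) →
          e (FundamentalGroup.fromPath (Path.Homotopic.Quotient.mk δ)) = QuotientGroup.mk w) ∧
    (∀ n : ℕ, CartanTorus.IsAlgebraic (CartanTorus.specialLinear n) ∧
      ConnectedSpace (CartanTorus.specialLinear n) ∧
      SimplyConnectedSpace (CartanTorus.specialLinear n)) := by
  refine ⟨fun n G hG _ hsc 𝔱 h𝔱 T₀ hT₀ => ?_, fun n => ?_⟩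
  · subst hT₀
    exact CartanTorus.exists_fundamentalGroup_mulEquiv_weylGroup hG h𝔱.self_normalizing
  · have := CartanTorus.simplyConnectedSpace_specialLinear n
    exact ⟨CartanTorus.isAlgebraic_specialLinear n, inferInstance, this⟩
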